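/- Let $n\ge 1$ and $\eta>0$. For a real $n\times n$ matrix $X$ let $\|X\|_\infty$ denote the Euclidean operator norm, for symmetric $X$ let $\lambda_{\max}(X)$ denote the largest eigenvalue, and let $\langle Y,X\rangle=\operatorname{tr}(Y^TX)$. For a symmetric $n\times n$ matrix $Y$ define the average mirror projection $$\bar{\mathsf P}(Y)=\mathbb{E}_u\left[\frac{e^{Y/2}uu^Te^{Y/2}}{u^Te^{Y}u}\right],$$ where $u$ is uniformly distributed on the unit sphere of $\mathbb{R}^n$. Let $T\in\mathbb{N}$, let $G_1,\dots,G_T$ be any sequence of symmetric $n\times n$ real matrices, and let $\bar X_t=\bar{\mathsf P}\big(\eta\sum_{i=1}^{t-1}G_i\big)$. Then $$\lambda_{\max}\Big(\sum_{t=1}^TG_t\Big)-\sum_{t=1}^T\langle G_t,\bar X_t\rangle\le\frac{\log(4n)}{\eta}+\frac{3\eta}{2}\sum_{t=1}^T\|G_t\|_\infty^2 .$$ If additionally $0\preceq G_t\preceq I$ for every $t$ and $\eta\le\frac16$, then $$\lambda_{\max}\Big(\sum_{t=1}^TG_t\Big)-\sum_{t=1}^T\langle G_t,\bar X_t\rangle\le\frac{\log(4n)}{\eta}+3\eta\,\lambda_{\max}\Big(\sum_{t=1}^TG_t\Big).$$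 -/

import Mathlib

open scoped Matrix

namespace RankOneSketch

noncomputable section

/-- The uniform probability distribution on the unit sphere of `ℝⁿ`:
the normalized surface measure induced by Lebesgue measure. -/
def uniformSphere (n : ℕ) :
    MeasureTheory.Measure (Metric.sphere (0 : EuclideanSpace ℝ (Fin n)) 1) :=
  ((MeasureTheory.volume : MeasureTheory.Measure (EuclideanSpace ℝ (Fin n))).toSphere
      Set.univ)⁻¹ •
    (MeasureTheory.volume : MeasureTheory.Measure (EuclideanSpace ℝ (Fin n))).toSphere

/-- The randomized mirror projection
`P_u(Y) = e^{Y/2} u uᵀ e^{Y/2} / (uᵀ e^Y u)`. -/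
def randProj {n : ℕ} (u : Fin n → ℝ) (Y : Matrix (Fin n) (Fin n) ℝ) :
    Matrix (Fin n) (Fin n) ℝ :=
  (u ⬝ᵥ (NormedSpace.exp Y *ᵥ u))⁻¹ •
    (NormedSpace.exp ((1 / 2 : ℝ) • Y) * Matrix.vecMulVec u u *
      NormedSpace.exp ((1 / 2 : ℝ) • Y))

/-- The average mirror projection: the (entrywise) expectation of `P_u(Y)` over `u` uniform
on the unit sphere. -/
def avgProj {n : ℕ} (Y : Matrix (Fin n) (Fin n) ℝ) : Matrix (Fin n) (Fin n) ℝ :=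
  Matrix.of fun i j =>
    ∫ u : Metric.sphere (0 : EuclideanSpace ℝ (Fin n)) 1,
      randProj (fun k => (u : EuclideanSpace ℝ (Fin n)) k) Y i j ∂(uniformSphere n)

/-- The action `X̄_t = P̄(η ∑_{i=1}^{t-1} G_i)`. -/
def avgAction {n : ℕ} (η : ℝ) (G : ℕ → Matrix (Fin n) (Fin n) ℝ) (t : ℕ) :
    Matrix (Fin n) (Fin n) ℝ :=
  avgProj (η • ∑ i ∈ Finset.Ico 1 t, G i)

/-- The Frobenius inner product `⟨Y, X⟩ = tr(Yᵀ X)`. -/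
def frobInner {n : ℕ} (Y X : Matrix (Fin n) (Fin n) ℝ) : ℝ := (Yᵀ * X).trace

/-- The largest eigenvalue of a (symmetric) matrix. -/
def lambdaMax {n : ℕ} (A : Matrix (Fin n) (Fin n) ℝ) : ℝ := sSup (spectrum ℝ A)

/-- The Euclidean operator norm of a matrix. -/
def opNorm {n : ℕ} (A : Matrix (Fin n) (Fin n) ℝ) : ℝ :=
  ‖Matrix.toEuclideanCLM (n := Fin n) (𝕜 := ℝ) A‖

end

end RankOneSketch

/-! The argument is follow-the-regularized-leader with the potential Φ(Y) = E log(yᵀ e^Y y), y a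
Gaussian vector; its gradient is the average mirror projection, since that projection depends only
on the direction of y. Frullani's formula turns differences of Φ into one-dimensional integrals:
Φ(B) - Φ(A) = ∫₀^∞ (w_A(t) - w_B(t))/t dt with w_Y(t) = det(1 + t e^Y)^(-1/2). This formula is the
heuristic; the formal proof works with the integral alone, through upper bounds on it
(`PotentialGapLE`).

The projection enters through 1/q = ∫ e^(-tq) dt: Gaussian integration shows that P̄(A), tested
against any matrix, acts as a diagonal operator in the eigenbasis of A, with eigenvalues ∫ w_A(t)
σ_t(aᵢ)/(2t) dt, σ_t being the logistic function (`frobInner_avgProj`,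
`ratioDensity_exp_eigenvalues`).

Smoothness. Since log w_Y = -½ tr f_t(Y) with f_t the softplus, the inequality eˣ ≥ 1 + x bounds w_A
- w_B by ½ w_A (tr f_t(B) - tr f_t(A)), so it suffices to bound the trace difference for each t by
logistic weights of A (`potentialGapLE_of_sum_softplus_le`). Scalar inequalities for f_t lift to
such trace inequalities through the overlaps of two eigenbases. They give Φ(B) - Φ(A) ≤ ⟨B - A,
P̄(A)⟩ + (3/2)‖B - A‖² in general (`potentialGapLE_opNorm`), and a factor 1 + 3η on the linear term
when B - A = ηG with 0 ⪯ G ⪯ I (`potentialGapLE_posSemidef`).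

Range. Keeping one factor of w_Y gives Φ(Y) - Φ(0) ≥ λ_max(Y) - log(4n) (`eigenvalue_sub_log_le`).
Summing the smoothness bounds along the partial sums and dividing by η gives both claims. -/

namespace RankOneSketch
noncomputable section

open MeasureTheory Filter Topology Set

variable {n : ℕ}

/-! ### Scalar inequalities for softplus and logistic -/

/-- The shifted softplus function `x ↦ log (1 + t eˣ)`. -/
def softplus (t x : ℝ) : ℝ := Real.log (1 + t * Real.exp x)

/-- The shifted logistic function, which is the derivative of `softplus t`. -/
def logistic (t x : ℝ) : ℝ := t * Real.exp x / (1 + t * Real.exp x)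

lemma one_add_mul_exp_pos {t : ℝ} (ht : 0 < t) (x : ℝ) : 0 < 1 + t * Real.exp x := by positivity

lemma logistic_pos {t : ℝ} (ht : 0 < t) (x : ℝ) : 0 < logistic t x := by
  unfold logistic; positivity

lemma logistic_le_one {t : ℝ} (ht : 0 < t) (x : ℝ) : logistic t x ≤ 1 := by
  have := one_add_mul_exp_pos ht x
  rw [logistic, div_le_one this]; linarith

lemma logistic_mono {t : ℝ} (ht : 0 < t) : Monotone (logistic t) := by
  intro x y hxy
  have hx := one_add_mul_exp_pos ht x
  have hy := one_add_mul_exp_pos ht y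
  have := mul_le_mul_of_nonneg_left (Real.exp_le_exp.2 hxy) ht.le
  rw [logistic, logistic, div_le_div_iff₀ hx hy]
  nlinarith

lemma logistic_add_le {t : ℝ} (ht : 0 < t) (x : ℝ) {d : ℝ} (hd : 0 ≤ d) :
    logistic t (x + d) ≤ Real.exp d * logistic t x := by
  have hx := one_add_mul_exp_pos ht x
  have hm : 1 + t * Real.exp x ≤ 1 + t * Real.exp (x + d) := by gcongr; linarith
  calc logistic t (x + d) = t * Real.exp (x + d) / (1 + t * Real.exp (x + d)) := rfl
    _ ≤ t * Real.exp (x + d) / (1 + t * Real.exp x) := by gcongr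
    _ = Real.exp d * logistic t x := by rw [logistic, Real.exp_add]; ring

lemma hasDerivAt_softplus {t : ℝ} (ht : 0 < t) (x : ℝ) :
    HasDerivAt (softplus t) (logistic t x) x :=
  (((Real.hasDerivAt_exp x).const_mul t).const_add 1).log (one_add_mul_exp_pos ht x).ne'

lemma hasDerivAt_logistic {t : ℝ} (ht : 0 < t) (x : ℝ) :
    HasDerivAt (logistic t) (logistic t x * (1 - logistic t x)) x := by
  have h := one_add_mul_exp_pos ht x
  have := ((Real.hasDerivAt_exp x).const_mul t).div
    (((Real.hasDerivAt_exp x).const_mul t).const_add 1) h.ne'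
  refine this.congr_deriv ?_
  unfold logistic
  field_simp

/-- This is convexity of softplus, with the tangent taken at y. It reduces to convexity of exp at
the points 0 and x - y, with weights 1 - σ(y) and σ(y). -/
lemma softplus_sub_le {t : ℝ} (ht : 0 < t) (x y : ℝ) :
    softplus t y - softplus t x ≤ (y - x) * logistic t y := by
  have hx := one_add_mul_exp_pos ht x
  have hy := one_add_mul_exp_pos ht y
  have h0 := logistic_pos ht y
  have h1 := logistic_le_one ht y
  have key := convexOn_exp.2 (Set.mem_univ 0) (Set.mem_univ (x - y))
    (sub_nonneg.2 h1) h0.le (by ring)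
  simp only [smul_eq_mul, mul_zero, zero_add, Real.exp_zero, mul_one] at key
  have e : 1 - logistic t y + logistic t y * Real.exp (x - y)
      = (1 + t * Real.exp x) / (1 + t * Real.exp y) := by
    rw [Real.exp_sub, logistic]; field_simp; ring
  rw [e] at key
  have := (Real.le_log_iff_exp_le (div_pos hx hy)).2 key
  rw [Real.log_div hx.ne' hy.ne'] at this
  unfold softplus
  linarith

/-- Equivalent to tanh(d/2) ≤ d/2. -/
lemma exp_sub_one_le {d : ℝ} (hd : 0 ≤ d) : Real.exp d - 1 ≤ d / 2 * (Real.exp d + 1) := by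
  have hder : ∀ x : ℝ, HasDerivAt (fun x => x / 2 * (Real.exp x + 1) - (Real.exp x - 1))
      (1 / 2 * (Real.exp x + 1) + x / 2 * Real.exp x - Real.exp x) x := fun x =>
    (((hasDerivAt_id x).div_const 2).mul ((Real.hasDerivAt_exp x).add_const 1)).sub
      ((Real.hasDerivAt_exp x).sub_const 1)
  have hm : Monotone (fun x => x / 2 * (Real.exp x + 1) - (Real.exp x - 1)) := by
    refine monotone_of_hasDerivAt_nonneg hder fun x => ?_
    have h1 : 1 - x ≤ Real.exp (-x) := by linarith [Real.add_one_le_exp (-x)]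
    have h2 := mul_le_mul_of_nonneg_right h1 (Real.exp_pos x).le
    rw [← Real.exp_add, neg_add_cancel, Real.exp_zero] at h2
    simp only [Pi.zero_apply]
    linarith
  have := hm hd
  norm_num at this
  linarith

lemma logistic_sub_le {t : ℝ} (ht : 0 < t) {x y : ℝ} (hxy : x ≤ y) :
    logistic t y - logistic t x ≤ (y - x) / 2 * (logistic t x + logistic t y) := by
  have hx := one_add_mul_exp_pos ht x
  have hy := one_add_mul_exp_pos ht y
  have h := exp_sub_one_le (sub_nonneg.2 hxy)
  have e : Real.exp y = Real.exp (y - x) * Real.exp x := by rw [← Real.exp_add]; ring_nf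
  have hd : 0 ≤ (y - x) / 2 := by linarith
  have h2 : t * Real.exp y - t * Real.exp x
      ≤ (y - x) / 2 * (t * Real.exp x + t * Real.exp y
        + 2 * (t * Real.exp x) * (t * Real.exp y)) := by
    have h3 := mul_le_mul_of_nonneg_right h (mul_pos ht (Real.exp_pos x)).le
    have h4 : 0 ≤ (y - x) / 2 * (2 * (t * Real.exp x) * (t * Real.exp y)) := by positivity
    rw [e] at h4 ⊢
    linarith
  have e1 : logistic t y - logistic t x = (t * Real.exp y - t * Real.exp x) /
      ((1 + t * Real.exp x) * (1 + t * Real.exp y)) := by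
    unfold logistic; field_simp; ring
  have e2 : (y - x) / 2 * (logistic t x + logistic t y) =
      ((y - x) / 2 * (t * Real.exp x + t * Real.exp y
        + 2 * (t * Real.exp x) * (t * Real.exp y))) /
      ((1 + t * Real.exp x) * (1 + t * Real.exp y)) := by
    unfold logistic; field_simp; ring
  rw [e1, e2]
  gcongr

lemma sub_mul_logistic_sub_le {t : ℝ} (ht : 0 < t) (x y : ℝ) :
    (y - x) * (logistic t y - logistic t x)
      ≤ (y - x) ^ 2 / 2 * (logistic t x + logistic t y) := by
  rcases le_total x y with h | h
  · have := mul_le_mul_of_nonneg_left (logistic_sub_le ht h) (sub_nonneg.2 h)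
    linarith
  · have := mul_le_mul_of_nonneg_left (logistic_sub_le ht h) (sub_nonneg.2 h)
    linarith

/-- A bound on the Bregman divergence of the softplus function. -/
lemma softplus_bregman_le {t : ℝ} (ht : 0 < t) (x y : ℝ) :
    softplus t y - softplus t x - (y - x) * logistic t x
      ≤ (y - x) ^ 2 / 4 * (2 * logistic t x + logistic t y) := by
  have hx0 := logistic_pos ht x
  have hy0 := logistic_pos ht y
  rcases le_total x y with h | h
  -- For x ≤ y the stronger bound with σ(x) + σ(y) holds: the gap vanishes at z = x, and its
  -- derivative is nonnegative by `logistic_sub_le`.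
  · have hder : ∀ z : ℝ, HasDerivAt (fun z => (z - x) ^ 2 / 4 * (logistic t x + logistic t z)
        - (softplus t z - softplus t x - (z - x) * logistic t x))
        ((2 * (z - x)) / 4 * (logistic t x + logistic t z)
          + (z - x) ^ 2 / 4 * (logistic t z * (1 - logistic t z))
          - (logistic t z - 1 * logistic t x)) z := fun z => by
      have hz : HasDerivAt (fun z => z - x) 1 z := (hasDerivAt_id z).sub_const x
      refine (((hz.pow 2).div_const 4).mul ((hasDerivAt_logistic ht z).const_add _)).sub
        (((hasDerivAt_softplus ht z).sub_const _).sub (hz.mul_const _)) |>.congr_deriv ?_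
      simp
    have hm : MonotoneOn (fun z => (z - x) ^ 2 / 4 * (logistic t x + logistic t z)
        - (softplus t z - softplus t x - (z - x) * logistic t x)) (Set.Ici x) := by
      refine monotoneOn_of_deriv_nonneg (convex_Ici x)
        (fun z _ => (hder z).continuousAt.continuousWithinAt)
        (fun z _ => (hder z).differentiableAt.differentiableWithinAt) fun z hz => ?_
      rw [interior_Ici] at hz
      rw [(hder z).deriv]
      have h1 := logistic_sub_le ht (le_of_lt hz)
      have h2 : 0 ≤ (z - x) ^ 2 / 4 * (logistic t z * (1 - logistic t z)) := by
        have := logistic_pos ht z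
        have := sub_nonneg.2 (logistic_le_one ht z)
        positivity
      linarith
    have := hm Set.self_mem_Ici h h
    simp only [sub_self] at this
    nlinarith [mul_nonneg (sq_nonneg (y - x)) hx0.le]
  -- For y ≤ x the term 2σ(x) suffices: the derivative has the right sign because σ(z) ≥ e^(z-x)
  -- σ(x) ≥ (1 + z - x) σ(x).
  · have hder : ∀ z : ℝ, HasDerivAt (fun z => (z - x) ^ 2 / 2 * logistic t x
        - (softplus t z - softplus t x - (z - x) * logistic t x))
        ((2 * (z - x)) / 2 * logistic t x - (logistic t z - 1 * logistic t x)) z := fun z => by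
      have hz : HasDerivAt (fun z => z - x) 1 z := (hasDerivAt_id z).sub_const x
      refine (((hz.pow 2).div_const 2).mul_const _).sub
        (((hasDerivAt_softplus ht z).sub_const _).sub (hz.mul_const _)) |>.congr_deriv ?_
      simp
    have hm : AntitoneOn (fun z => (z - x) ^ 2 / 2 * logistic t x
        - (softplus t z - softplus t x - (z - x) * logistic t x)) (Set.Iic x) := by
      refine antitoneOn_of_deriv_nonpos (convex_Iic x)
        (fun z _ => (hder z).continuousAt.continuousWithinAt)
        (fun z _ => (hder z).differentiableAt.differentiableWithinAt) fun z hz => ?_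
      rw [interior_Iic] at hz
      rw [(hder z).deriv]
      have h1 := logistic_add_le ht z (sub_nonneg.2 (le_of_lt hz))
      rw [add_sub_cancel] at h1
      have h2 := mul_le_mul_of_nonneg_left h1 (Real.exp_pos (z - x)).le
      rw [← mul_assoc, ← Real.exp_add, sub_add_sub_cancel, sub_self, Real.exp_zero] at h2
      have h3 := mul_le_mul_of_nonneg_right (Real.add_one_le_exp (z - x)) hx0.le
      linarith
    have := hm h Set.self_mem_Iic h
    simp only [sub_self] at this
    nlinarith [mul_nonneg (sq_nonneg (y - x)) hy0.le]

/-! ### Trace inequalities from the overlaps of two eigenbases -/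

section Operators

variable {E : Type*} [NormedAddCommGroup E] [InnerProductSpace ℝ E]
  {ι : Type*} [Fintype ι] {A B : E →L[ℝ] E} {u v : OrthonormalBasis ι ℝ E} {a b : ι → ℝ}

lemma inner_sub_apply_eigenvector (hA : ∀ i, A (u i) = a i • u i)
    (hB : ∀ j, B (v j) = b j • v j) (hBs : ∀ x y, inner ℝ (B x) y = inner ℝ x (B y)) (i j : ι) :
    inner ℝ (v j) ((B - A) (u i)) = (b j - a i) * inner ℝ (v j) (u i) := by
  rw [sub_apply, inner_sub_right, ← hBs, hA, hB, inner_smul_left,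
    inner_smul_right]
  simp
  ring

lemma sum_sq_inner_mul_sub (hA : ∀ i, A (u i) = a i • u i)
    (hB : ∀ j, B (v j) = b j • v j) (hBs : ∀ x y, inner ℝ (B x) y = inner ℝ x (B y)) (i : ι) :
    ∑ j, inner ℝ (v j) (u i) ^ 2 * (b j - a i) = inner ℝ (u i) ((B - A) (u i)) := by
  rw [← v.sum_inner_mul_inner (u i)]
  refine Finset.sum_congr rfl fun j _ => ?_
  rw [inner_sub_apply_eigenvector hA hB hBs, real_inner_comm]
  ring

lemma sum_sq_inner_mul_sub_sq (hA : ∀ i, A (u i) = a i • u i)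
    (hB : ∀ j, B (v j) = b j • v j) (hBs : ∀ x y, inner ℝ (B x) y = inner ℝ x (B y)) (i : ι) :
    ∑ j, inner ℝ (v j) (u i) ^ 2 * (b j - a i) ^ 2 = ‖(B - A) (u i)‖ ^ 2 := by
  rw [← v.sum_sq_norm_inner_right]
  refine Finset.sum_congr rfl fun j _ => ?_
  rw [inner_sub_apply_eigenvector hA hB hBs, Real.norm_eq_abs, sq_abs]
  ring

lemma sum_sq_inner_basis (u v : OrthonormalBasis ι ℝ E) (i : ι) :
    ∑ j, inner ℝ (v j) (u i) ^ 2 = 1 := by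
  have := v.sum_sq_norm_inner_right (u i)
  simpa using this

lemma inner_self_apply_eq_sum (hA : ∀ i, A (u i) = a i • u i)
    (hAs : ∀ x y, inner ℝ (A x) y = inner ℝ x (A y)) (x : E) :
    inner ℝ x (A x) = ∑ i, a i * inner ℝ (u i) x ^ 2 := by
  rw [← u.sum_inner_mul_inner x]
  refine Finset.sum_congr rfl fun i _ => ?_
  rw [← hAs, hA, inner_smul_left, real_inner_comm]
  simp
  ring

/-- Expansion of a double sum weighted by the overlaps of two orthonormal bases. -/
lemma sum_sum_sq_inner_mul (u v : OrthonormalBasis ι ℝ E) (f g : ι → ℝ) :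
    ∑ i, ∑ j, inner ℝ (v j) (u i) ^ 2 * (f j - g i) = ∑ j, f j - ∑ i, g i := by
  simp_rw [mul_sub, Finset.sum_sub_distrib]
  congr 1
  · rw [Finset.sum_comm]
    refine Finset.sum_congr rfl fun j _ => ?_
    simp_rw [real_inner_comm (u _) (v j)]
    rw [← Finset.sum_mul, sum_sq_inner_basis v u, one_mul]
  · refine Finset.sum_congr rfl fun i _ => ?_
    rw [← Finset.sum_mul, sum_sq_inner_basis, one_mul]

variable (hA : ∀ i, A (u i) = a i • u i) (hB : ∀ j, B (v j) = b j • v j)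
  (hAs : ∀ x y, inner ℝ (A x) y = inner ℝ x (A y))
  (hBs : ∀ x y, inner ℝ (B x) y = inner ℝ x (B y))

include hA hB hBs in
lemma sum_sum_left_mul_sub (f : ι → ℝ) :
    ∑ i, ∑ j, inner ℝ (v j) (u i) ^ 2 * (f i * (b j - a i))
      = ∑ i, f i * inner ℝ (u i) ((B - A) (u i)) := by
  refine Finset.sum_congr rfl fun i _ => ?_
  rw [← sum_sq_inner_mul_sub hA hB hBs, Finset.mul_sum]
  exact Finset.sum_congr rfl fun j _ => by ring

include hA hB hAs in
lemma sum_sum_right_mul_sub (f : ι → ℝ) :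
    ∑ i, ∑ j, inner ℝ (v j) (u i) ^ 2 * (f j * (b j - a i))
      = ∑ j, f j * inner ℝ (v j) ((B - A) (v j)) := by
  rw [Finset.sum_comm]
  refine Finset.sum_congr rfl fun j _ => ?_
  have := sum_sq_inner_mul_sub hB hA hAs j
  rw [← neg_sub A B, neg_apply, inner_neg_right, ← this,
    ← Finset.sum_neg_distrib, Finset.mul_sum]
  refine Finset.sum_congr rfl fun i _ => ?_
  rw [real_inner_comm]
  ring

include hA hB hBs in
lemma sum_sum_left_mul_sub_sq (f : ι → ℝ) :
    ∑ i, ∑ j, inner ℝ (v j) (u i) ^ 2 * (f i * (b j - a i) ^ 2)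
      = ∑ i, f i * ‖(B - A) (u i)‖ ^ 2 := by
  refine Finset.sum_congr rfl fun i _ => ?_
  rw [← sum_sq_inner_mul_sub_sq hA hB hBs, Finset.mul_sum]
  exact Finset.sum_congr rfl fun j _ => by ring

include hA hB hAs in
lemma sum_sum_right_mul_sub_sq (f : ι → ℝ) :
    ∑ i, ∑ j, inner ℝ (v j) (u i) ^ 2 * (f j * (b j - a i) ^ 2)
      = ∑ j, f j * ‖(B - A) (v j)‖ ^ 2 := by
  rw [Finset.sum_comm]
  refine Finset.sum_congr rfl fun j _ => ?_
  have := sum_sq_inner_mul_sub_sq hB hA hAs j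
  rw [← neg_sub A B, neg_apply, norm_neg, ← this, Finset.mul_sum]
  refine Finset.sum_congr rfl fun i _ => ?_
  rw [real_inner_comm]
  ring

-- Klein's inequality for softplus, with the derivative taken at B.
include hA hB hAs in
lemma sum_softplus_sub_le {t : ℝ} (ht : 0 < t) :
    ∑ j, softplus t (b j) - ∑ i, softplus t (a i)
      ≤ ∑ j, logistic t (b j) * inner ℝ (v j) ((B - A) (v j)) := by
  rw [← sum_sum_sq_inner_mul u v, ← sum_sum_right_mul_sub hA hB hAs]
  refine Finset.sum_le_sum fun i _ => Finset.sum_le_sum fun j _ => ?_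
  refine mul_le_mul_of_nonneg_left ?_ (sq_nonneg _)
  have := softplus_sub_le ht (a i) (b j)
  linarith

include hA hB hAs hBs in
lemma sum_logistic_mul_sub_le {t : ℝ} (ht : 0 < t) :
    ∑ j, logistic t (b j) * inner ℝ (v j) ((B - A) (v j))
        - ∑ i, logistic t (a i) * inner ℝ (u i) ((B - A) (u i))
      ≤ (∑ i, logistic t (a i) * ‖(B - A) (u i)‖ ^ 2
        + ∑ j, logistic t (b j) * ‖(B - A) (v j)‖ ^ 2) / 2 := by
  rw [← sum_sum_right_mul_sub hA hB hAs, ← sum_sum_left_mul_sub hA hB hBs,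
    ← sum_sum_right_mul_sub_sq hA hB hAs, ← sum_sum_left_mul_sub_sq hA hB hBs]
  simp only [← Finset.sum_sub_distrib, ← Finset.sum_add_distrib, Finset.sum_div]
  refine Finset.sum_le_sum fun i _ => Finset.sum_le_sum fun j _ => ?_
  have := mul_le_mul_of_nonneg_left (sub_mul_logistic_sub_le ht (a i) (b j))
    (sq_nonneg (inner ℝ (v j) (u i)))
  linarith

include hA hB hAs hBs in
lemma sum_softplus_bregman_le {t : ℝ} (ht : 0 < t) :
    ∑ j, softplus t (b j) - ∑ i, softplus t (a i)
        - ∑ i, logistic t (a i) * inner ℝ (u i) ((B - A) (u i))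
      ≤ (2 * ∑ i, logistic t (a i) * ‖(B - A) (u i)‖ ^ 2
        + ∑ j, logistic t (b j) * ‖(B - A) (v j)‖ ^ 2) / 4 := by
  rw [← sum_sum_sq_inner_mul u v, ← sum_sum_left_mul_sub hA hB hBs,
    ← sum_sum_right_mul_sub_sq hA hB hAs, ← sum_sum_left_mul_sub_sq hA hB hBs]
  simp only [← Finset.sum_sub_distrib, ← Finset.sum_add_distrib, Finset.sum_div, Finset.mul_sum]
  refine Finset.sum_le_sum fun i _ => Finset.sum_le_sum fun j _ => ?_
  have := mul_le_mul_of_nonneg_left (softplus_bregman_le ht (a i) (b j))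
    (sq_nonneg (inner ℝ (v j) (u i)))
  linarith

end Operators

/-! ### Eigenvalue comparison and semidefinite order -/

/-- Weyl's monotonicity inequality for eigenvalues. -/
lemma eigenvalue_le_add {E : Type*} [NormedAddCommGroup E] [InnerProductSpace ℝ E]
    {m : ℕ} {A B : E →L[ℝ] E} {u v : OrthonormalBasis (Fin m) ℝ E} {a b : Fin m → ℝ}
    (hA : ∀ i, A (u i) = a i • u i) (hB : ∀ j, B (v j) = b j • v j)
    (hAs : ∀ x y, inner ℝ (A x) y = inner ℝ x (A y))
    (hBs : ∀ x y, inner ℝ (B x) y = inner ℝ x (B y))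
    (ha : Antitone a) (hb : Antitone b) {d : ℝ}
    (hd : ∀ x, inner ℝ x (B x) ≤ inner ℝ x (A x) + d * ‖x‖ ^ 2) (k : Fin m) :
    b k ≤ a k + d := by
  have : FiniteDimensional ℝ E := u.toBasis.finiteDimensional_of_finite
  -- A nonzero x orthogonal to uᵢ for i < k and to vᵢ for i > k is needed: only m - 1 conditions.
  -- The zero entry at index k makes L non-surjective, hence non-injective. On such an x, the form
  -- of A is at most a k and that of B at least b k, relative to ‖x‖².
  let L : E →ₗ[ℝ] (Fin m → ℝ) := LinearMap.pi fun i =>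
    if i < k then (innerSL ℝ (u i)).toLinearMap
    else if k < i then (innerSL ℝ (v i)).toLinearMap else 0
  have hL : ¬ Function.Injective L := by
    rw [LinearMap.injective_iff_surjective_of_finrank_eq_finrank
      (by rw [Module.finrank_eq_card_basis u.toBasis]; simp)]
    intro h
    obtain ⟨x, hx⟩ := h (Pi.single k 1)
    have := congrFun hx k
    simp [L] at this
  obtain ⟨x, hx, hx0⟩ : ∃ x, L x = 0 ∧ x ≠ 0 := by
    rw [← LinearMap.ker_eq_bot, Submodule.eq_bot_iff] at hL
    push Not at hL
    exact hL
  have hu : ∀ i, i < k → inner ℝ (u i) x = 0 := fun i hi => by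
    have := congrFun hx i
    simpa [L, hi] using this
  have hv : ∀ i, k < i → inner ℝ (v i) x = 0 := fun i hi => by
    have := congrFun hx i
    simpa [L, hi, hi.not_gt] using this
  have h1 : inner ℝ x (A x) ≤ a k * ‖x‖ ^ 2 := by
    rw [inner_self_apply_eq_sum hA hAs, ← u.sum_sq_norm_inner_right, Finset.mul_sum]
    refine Finset.sum_le_sum fun i _ => ?_
    rw [Real.norm_eq_abs, sq_abs]
    rcases lt_or_ge i k with h | h
    · simp [hu i h]
    · exact mul_le_mul_of_nonneg_right (ha h) (sq_nonneg _)
  have h2 : b k * ‖x‖ ^ 2 ≤ inner ℝ x (B x) := by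
    rw [inner_self_apply_eq_sum hB hBs, ← v.sum_sq_norm_inner_right, Finset.mul_sum]
    refine Finset.sum_le_sum fun i _ => ?_
    rw [Real.norm_eq_abs, sq_abs]
    rcases lt_or_ge k i with h | h
    · simp [hv i h]
    · exact mul_le_mul_of_nonneg_right (hb h) (sq_nonneg _)
  have h3 : 0 < ‖x‖ ^ 2 := by positivity
  have h4 := hd x
  refine le_of_mul_le_mul_right ?_ h3
  linarith

/-- A real matrix as an operator on Euclidean space. -/
abbrev toOp (A : Matrix (Fin n) (Fin n) ℝ) :
    EuclideanSpace ℝ (Fin n) →L[ℝ] EuclideanSpace ℝ (Fin n) :=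
  Matrix.toEuclideanCLM (n := Fin n) (𝕜 := ℝ) A

lemma toOp_symm {A : Matrix (Fin n) (Fin n) ℝ} (hA : A.IsHermitian)
    (x y : EuclideanSpace ℝ (Fin n)) : inner ℝ (toOp A x) y = inner ℝ x (toOp A y) :=
  Matrix.isSymmetric_toEuclideanLin_iff.mpr hA x y

lemma toOp_eigenvectorBasis {A : Matrix (Fin n) (Fin n) ℝ} (hA : A.IsHermitian) (i : Fin n) :
    toOp A (hA.eigenvectorBasis i) = hA.eigenvalues i • hA.eigenvectorBasis i := by
  ext1 k
  simpa using congrFun (hA.mulVec_eigenvectorBasis i) k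

lemma inner_toOp_le (D : Matrix (Fin n) (Fin n) ℝ) (x : EuclideanSpace ℝ (Fin n)) :
    |inner ℝ x (toOp D x)| ≤ opNorm D * ‖x‖ ^ 2 := by
  calc |inner ℝ x (toOp D x)| ≤ ‖x‖ * ‖toOp D x‖ := abs_real_inner_le_norm _ _
    _ ≤ ‖x‖ * (opNorm D * ‖x‖) := by gcongr; exact (toOp D).le_opNorm x
    _ = _ := by ring

lemma sum_logistic_le {A B : Matrix (Fin n) (Fin n) ℝ} (hA : A.IsHermitian) (hB : B.IsHermitian)
    {t : ℝ} (ht : 0 < t) :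
    ∑ j, logistic t (hB.eigenvalues j)
      ≤ Real.exp (opNorm (B - A)) * ∑ i, logistic t (hA.eigenvalues i) := by
  have hd0 : 0 ≤ opNorm (B - A) := norm_nonneg _
  -- Weyl's inequality needs decreasing order, hence `eigenvalues₀`; `eigenvalues` reindexes it in
  -- the same way for both matrices, so the comparison stays termwise.
  have key : ∀ k, hB.eigenvalues₀ k ≤ hA.eigenvalues₀ k + opNorm (B - A) := by
    refine fun k => eigenvalue_le_add (A := toOp A) (B := toOp B)
      (u := (Matrix.isSymmetric_toEuclideanLin_iff.mpr hA).eigenvectorBasis finrank_euclideanSpace)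
      (v := (Matrix.isSymmetric_toEuclideanLin_iff.mpr hB).eigenvectorBasis finrank_euclideanSpace)
      (fun i => ?_) (fun j => ?_) (toOp_symm hA) (toOp_symm hB)
      hA.eigenvalues₀_antitone hB.eigenvalues₀_antitone (fun x => ?_) k
    · exact (Matrix.isSymmetric_toEuclideanLin_iff.mpr hA).apply_eigenvectorBasis
        finrank_euclideanSpace i
    · exact (Matrix.isSymmetric_toEuclideanLin_iff.mpr hB).apply_eigenvectorBasis
        finrank_euclideanSpace j
    · have h := (le_abs_self _).trans (inner_toOp_le (B - A) x)
      rw [toOp, map_sub, sub_apply, inner_sub_right] at h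
      linarith
  rw [Finset.mul_sum]
  refine Finset.sum_le_sum fun i _ => ?_
  exact (logistic_mono ht (key _)).trans (logistic_add_le ht _ hd0)

/-- This is G² ⪯ G, from G - G² = G(1 - G)G + (1 - G)G(1 - G), where both summands are positive
semidefinite. -/
lemma norm_toOp_sq_le_of_posSemidef {G : Matrix (Fin n) (Fin n) ℝ} (hG : G.PosSemidef)
    (hG' : (1 - G).PosSemidef) (x : EuclideanSpace ℝ (Fin n)) :
    ‖toOp G x‖ ^ 2 ≤ inner ℝ x (toOp G x) := by
  have hpos : ∀ {M : Matrix (Fin n) (Fin n) ℝ}, M.PosSemidef →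
      ∀ y : EuclideanSpace ℝ (Fin n), 0 ≤ inner ℝ y (toOp M y) := fun {M} hM y => by
    rw [Matrix.inner_toEuclideanCLM]
    simpa using hM.dotProduct_mulVec_nonneg y
  have h1 := hpos hG' (toOp G x)
  have h2 := hpos hG (toOp (1 - G) x)
  simp only [toOp, map_sub, map_one, sub_apply,
    one_apply_eq_self, inner_sub_left, inner_sub_right] at h1 h2
  rw [real_inner_self_eq_norm_sq] at h1 h2
  have h3 := toOp_symm hG.1 x (toOp G x)
  rw [real_inner_self_eq_norm_sq] at h3
  simp only [toOp] at *
  linarith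

/-! ### One-dimensional integrals producing log(4n) -/

lemma two_mul_le_log_sub_log {y : ℝ} (hy0 : 0 ≤ y) (hy1 : y < 1) :
    2 * y ≤ Real.log (1 + y) - Real.log (1 - y) := by
  -- The power series has nonnegative terms, the first being 2y.
  have h := Real.hasSum_log_sub_log_of_abs_lt_one (x := y) (by rwa [abs_of_nonneg hy0])
  have := sum_le_hasSum {0} (fun k _ => by positivity) h
  simpa using this

lemma two_div_le_log_div {n : ℕ} (hn : 2 ≤ n) :
    2 / (n : ℝ) ≤ Real.log (4 * ((n : ℝ) + 1)) - Real.log (4 * ((n : ℝ) - 1)) := by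
  have hn' : (2 : ℝ) ≤ n := by exact_mod_cast hn
  have h0 : (0 : ℝ) < n := by linarith
  have h := two_mul_le_log_sub_log (y := 1 / (n : ℝ)) (by positivity)
    (by rw [div_lt_one h0]; linarith)
  rw [← Real.log_div (by positivity)
    (sub_ne_zero.2 (by rw [ne_comm]; exact ((div_lt_one h0).2 (by linarith)).ne))] at h
  rw [← Real.log_div (by positivity) (mul_ne_zero (by norm_num) (by linarith))]
  convert h using 2
  · ring
  · have : (n : ℝ) - 1 ≠ 0 := by linarith
    have : 1 - 1 / (n : ℝ) ≠ 0 := by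
      rw [one_sub_div h0.ne']; positivity
    field_simp

lemma hasDerivAt_sqrt_one_add_mul {c t : ℝ} (hc : 0 < c) (ht : 0 ≤ t) :
    HasDerivAt (fun t => √(1 + t * c)) (c / (2 * √(1 + t * c))) t := by
  have h : HasDerivAt (fun t : ℝ => 1 + t * c) c t := by
    simpa using ((hasDerivAt_id t).mul_const c).const_add 1
  exact h.sqrt (by positivity)

lemma tendsto_sqrt_one_add_mul {c : ℝ} (hc : 0 < c) :
    Tendsto (fun t => √(1 + t * c)) atTop atTop :=
  Real.tendsto_sqrt_atTop.comp
    (tendsto_atTop_add_const_left _ _ (tendsto_id.atTop_mul_const hc))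

/-- A Frullani integral. -/
lemma integrable_inv_sqrt_sub_inv_sqrt {c : ℝ} (hc : 0 < c) :
    IntegrableOn (fun t => ((√(1 + t))⁻¹ - (√(1 + t * c))⁻¹) / t) (Ioi 0) ∧
    ∫ t in Ioi (0 : ℝ), ((√(1 + t))⁻¹ - (√(1 + t * c))⁻¹) / t = Real.log c := by
  -- Each logarithm is an antiderivative of (1 - (1 + te)^(-1/2))/t, with e = c or 1. These are not
  -- integrable at infinity separately; only the difference has a limit there.
  set K : ℝ → ℝ := fun t => 2 * Real.log (√(1 + t * c) + 1) - 2 * Real.log (√(1 + t * 1) + 1)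
  have hK' : ∀ {e : ℝ}, 0 < e → ∀ t : ℝ, 0 ≤ t → HasDerivAt
      (fun t => 2 * Real.log (√(1 + t * e) + 1)) (2 * (e / (2 * √(1 + t * e)) /
        (√(1 + t * e) + 1))) t :=
    fun he t ht => (((hasDerivAt_sqrt_one_add_mul he ht).add_const 1).log
      (by positivity)).const_mul 2
  have hsimp : ∀ {e : ℝ}, 0 < e → ∀ t : ℝ, 0 < t → 2 * (e / (2 * √(1 + t * e)) /
        (√(1 + t * e) + 1)) = (1 - (√(1 + t * e))⁻¹) / t := by
    intro e he t ht
    have h1 : 0 < √(1 + t * e) := by positivity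
    have h2 : √(1 + t * e) ^ 2 = 1 + t * e := Real.sq_sqrt (by positivity)
    field_simp
    rw [mul_comm t e] at h2
    linear_combination -h2
  have hK : ∀ t ∈ Ioi (0 : ℝ), HasDerivAt K (((√(1 + t))⁻¹ - (√(1 + t * c))⁻¹) / t) t := by
    intro t ht
    refine ((hK' hc t (le_of_lt ht)).sub (hK' one_pos t (le_of_lt ht))).congr_deriv ?_
    rw [hsimp hc t ht, hsimp one_pos t ht, mul_one]
    ring
  have hcont : ContinuousWithinAt K (Ici 0) 0 :=
    ((hK' hc 0 le_rfl).sub (hK' one_pos 0 le_rfl)).continuousAt.continuousWithinAt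
  have hlim : Tendsto K atTop (𝓝 (Real.log c)) := by
    have h1 : Tendsto (fun t : ℝ => (√(1 + t * 1))⁻¹) atTop (𝓝 0) :=
      (tendsto_sqrt_one_add_mul one_pos).inv_tendsto_atTop
    have h2 : Tendsto (fun t : ℝ => √(c + (1 - c) * (1 + t)⁻¹)) atTop (𝓝 (√c)) := by
      have : Tendsto (fun t : ℝ => c + (1 - c) * (1 + t)⁻¹) atTop (𝓝 (c + (1 - c) * 0)) :=
        ((tendsto_atTop_add_const_left _ _ tendsto_id).inv_tendsto_atTop.const_mul _).const_add _
      simpa using this.sqrt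
    have h3 : Tendsto (fun t : ℝ => 2 * Real.log ((√(c + (1 - c) * (1 + t)⁻¹) + (√(1 + t * 1))⁻¹) /
        (1 + (√(1 + t * 1))⁻¹))) atTop (𝓝 (2 * Real.log ((√c + 0) / (1 + 0)))) := by
      refine Tendsto.const_mul _ (Tendsto.log ((h2.add h1).div (h1.const_add 1) (by norm_num)) ?_)
      simp [(Real.sqrt_pos.2 hc).ne']
    have h4 : 2 * Real.log ((√c + 0) / (1 + 0)) = Real.log c := by
      rw [add_zero, add_zero, div_one, Real.log_sqrt hc.le]; ring
    rw [h4] at h3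
    refine h3.congr' ?_
    filter_upwards [eventually_gt_atTop 0] with t ht
    have hs : 0 < √(1 + t * 1) := by positivity
    have e1 : √(c + (1 - c) * (1 + t)⁻¹) = √(1 + t * c) / √(1 + t * 1) := by
      rw [← Real.sqrt_div (by positivity)]
      congr 1
      field_simp
      ring
    rw [e1]
    have e2 : (√(1 + t * c) / √(1 + t * 1) + (√(1 + t * 1))⁻¹) / (1 + (√(1 + t * 1))⁻¹)
        = (√(1 + t * c) + 1) / (√(1 + t * 1) + 1) := by
      field_simp
    rw [e2, Real.log_div (by positivity) (by positivity)]
    simp only [K]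
    ring
  have hK0 : Real.log c - K 0 = Real.log c := by simp [K]
  -- The integrand has constant sign on each side of c = 1, so convergence of the antiderivative
  -- already yields integrability.
  rcases le_total 1 c with h | h
  · have hpos : ∀ t ∈ Ioi (0 : ℝ), 0 ≤ ((√(1 + t))⁻¹ - (√(1 + t * c))⁻¹) / t := by
      intro t ht
      have ht' : 0 < t := ht
      refine div_nonneg (sub_nonneg.2 ?_) ht'.le
      have : t ≤ t * c := le_mul_of_one_le_right ht'.le h
      gcongr
    exact ⟨integrableOn_Ioi_deriv_of_nonneg hcont hK hpos hlim,
      (integral_Ioi_of_hasDerivAt_of_nonneg hcont hK hpos hlim).trans hK0⟩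
  · have hneg : ∀ t ∈ Ioi (0 : ℝ), ((√(1 + t))⁻¹ - (√(1 + t * c))⁻¹) / t ≤ 0 := by
      intro t ht
      have ht' : 0 < t := ht
      refine div_nonpos_of_nonpos_of_nonneg (sub_nonpos.2 ?_) ht'.le
      have : t * c ≤ t := mul_le_of_le_one_right ht'.le h
      gcongr
    exact ⟨integrableOn_Ioi_deriv_of_nonpos hcont hK hneg hlim,
      (integral_Ioi_of_hasDerivAt_of_nonpos hcont hK hneg hlim).trans hK0⟩

lemma integrable_inv_sqrt_pow {n : ℕ} (hn : 1 ≤ n) :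
    IntegrableOn (fun t => (√(1 + t))⁻¹ ^ (n + 2)) (Ioi 0) ∧
    ∫ t in Ioi (0 : ℝ), (√(1 + t))⁻¹ ^ (n + 2) = 2 / n := by
  have hn' : (n : ℝ) ≠ 0 := by positivity
  have hder : ∀ t ∈ Ici (0 : ℝ), HasDerivAt (fun t => -(2 / (n : ℝ)) * (√(1 + t))⁻¹ ^ n)
      ((√(1 + t))⁻¹ ^ (n + 2)) t := by
    intro t ht
    have ht' : (0 : ℝ) ≤ t := ht
    have h := hasDerivAt_sqrt_one_add_mul one_pos ht'
    simp only [mul_one] at h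
    have hs : 0 < √(1 + t) := by positivity
    refine (((h.inv hs.ne').pow n).const_mul _).congr_deriv ?_
    obtain ⟨m, rfl⟩ : ∃ m, n = m + 1 := ⟨n - 1, by omega⟩
    simp only [Nat.add_sub_cancel, inv_pow, pow_succ]
    field_simp
    simp
    field_simp
  have hpos : ∀ t ∈ Ioi (0 : ℝ), 0 ≤ (√(1 + t))⁻¹ ^ (n + 2) := fun t _ => by positivity
  have hlim : Tendsto (fun t => -(2 / (n : ℝ)) * (√(1 + t))⁻¹ ^ n) atTop (𝓝 0) := by
    have h := (tendsto_sqrt_one_add_mul one_pos).inv_tendsto_atTop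
    have := (h.pow n).const_mul (-(2 / (n : ℝ)))
    simpa [zero_pow (by omega : n ≠ 0)] using this
  refine ⟨integrableOn_Ioi_deriv_of_nonneg' hder hpos hlim, ?_⟩
  rw [integral_Ioi_of_hasDerivAt_of_nonneg' hder hpos hlim]
  simp

lemma integrable_inv_sqrt_sub_sq :
    IntegrableOn (fun t => ((√(1 + t))⁻¹ - (√(1 + t))⁻¹ ^ 2) / t) (Ioi 0) ∧
    ∫ t in Ioi (0 : ℝ), ((√(1 + t))⁻¹ - (√(1 + t))⁻¹ ^ 2) / t = Real.log 4 := by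
  set K : ℝ → ℝ := fun t => 2 * Real.log (√(1 + t) / (√(1 + t) + 1))
  have hK' : ∀ t ∈ Ici (0 : ℝ), HasDerivAt K (1 / ((1 + t) * (√(1 + t) + 1))) t := by
    intro t ht
    have ht' : (0 : ℝ) ≤ t := ht
    have h := hasDerivAt_sqrt_one_add_mul one_pos ht'
    simp only [mul_one] at h
    have hs : 0 < √(1 + t) := by positivity
    have hd : HasDerivAt (fun t => √(1 + t) / (√(1 + t) + 1)) _ t :=
      h.div (h.add_const 1) (by positivity)
    refine ((hd.log (by positivity)).const_mul 2).congr_deriv ?_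
    have h2 : √(1 + t) ^ 2 = 1 + t := Real.sq_sqrt (by positivity)
    rw [← h2, Real.sqrt_sq hs.le]
    field_simp
    ring
  have heq : ∀ t ∈ Ioi (0 : ℝ), 1 / ((1 + t) * (√(1 + t) + 1))
      = ((√(1 + t))⁻¹ - (√(1 + t))⁻¹ ^ 2) / t := by
    intro t ht
    have ht' : (0 : ℝ) < t := ht
    have hs : 0 < √(1 + t) := by positivity
    have h2 : √(1 + t) ^ 2 = 1 + t := Real.sq_sqrt (by positivity)
    field_simp
    rw [h2]
    have : √(1 + t) * √(1 + t) = 1 + t := by rw [← sq, h2]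
    linear_combination -(1 + t) * this
  have hpos : ∀ t ∈ Ioi (0 : ℝ), 0 ≤ 1 / ((1 + t) * (√(1 + t) + 1)) := fun t ht => by
    have : (0 : ℝ) < t := ht
    positivity
  have hlim : Tendsto K atTop (𝓝 0) := by
    have h := (tendsto_sqrt_one_add_mul one_pos).inv_tendsto_atTop
    simp only [mul_one] at h
    have h3 := (((h.const_add 1).inv₀ (by norm_num)).log (by norm_num)).const_mul 2
    simp only [add_zero, inv_one, Real.log_one, mul_zero] at h3
    refine h3.congr' ?_
    filter_upwards [eventually_gt_atTop 0] with t ht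
    have hs : 0 < √(1 + t) := by positivity
    simp only [K, Pi.inv_apply]
    congr 2
    field_simp
  constructor
  · exact (integrableOn_Ioi_deriv_of_nonneg' hK' hpos hlim).congr_fun heq measurableSet_Ioi
  · rw [← setIntegral_congr_fun measurableSet_Ioi heq,
      integral_Ioi_of_hasDerivAt_of_nonneg' hK' hpos hlim]
    have : Real.log 4 = 2 * Real.log 2 := by
      rw [show (4 : ℝ) = 2 ^ 2 by norm_num, Real.log_pow]; norm_num
    rw [this]
    simp only [K, add_zero, Real.sqrt_one, one_add_one_eq_two, one_div, Real.log_inv]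
    ring

/-- With s = (1 + t)^(-1/2), the identity 1 - s² = t s² gives (sⁿ - sⁿ⁺²)/t = sⁿ⁺², whose integral
is 2/n. -/
lemma integrable_inv_sqrt_sub_pow_step {n : ℕ} (hn : 1 ≤ n)
    (h : IntegrableOn (fun t => ((√(1 + t))⁻¹ - (√(1 + t))⁻¹ ^ n) / t) (Ioi 0)) :
    IntegrableOn (fun t => ((√(1 + t))⁻¹ - (√(1 + t))⁻¹ ^ (n + 2)) / t) (Ioi 0) ∧
    ∫ t in Ioi (0 : ℝ), ((√(1 + t))⁻¹ - (√(1 + t))⁻¹ ^ (n + 2)) / t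
      = (∫ t in Ioi (0 : ℝ), ((√(1 + t))⁻¹ - (√(1 + t))⁻¹ ^ n) / t) + 2 / n := by
  obtain ⟨h1, h2⟩ := integrable_inv_sqrt_pow hn
  have heq : ∀ t ∈ Ioi (0 : ℝ), ((√(1 + t))⁻¹ - (√(1 + t))⁻¹ ^ n) / t + (√(1 + t))⁻¹ ^ (n + 2)
      = ((√(1 + t))⁻¹ - (√(1 + t))⁻¹ ^ (n + 2)) / t := by
    intro t ht
    have ht' : (0 : ℝ) < t := ht
    have hs : (√(1 + t))⁻¹ ^ 2 * (1 + t) = 1 := by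
      rw [inv_pow, Real.sq_sqrt (by positivity)]; field_simp
    rw [div_add' _ _ _ ht'.ne', pow_add]
    congr 1
    linear_combination (√(1 + t))⁻¹ ^ n * hs
  refine ⟨(h.add h1).congr_fun heq measurableSet_Ioi, ?_⟩
  rw [← setIntegral_congr_fun measurableSet_Ioi heq, integral_add h h1, h2]

/-- For exponent N = n + 2 the bound is log(4(N - 1)), sharper than the log(4N) finally used. It is
an equality at N = 2, and it survives the step N → N + 2 because 2/N ≤ log((N + 1)/(N - 1)). -/
lemma integral_inv_sqrt_sub_pow_le_aux (n : ℕ) :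
    (IntegrableOn (fun t => ((√(1 + t))⁻¹ - (√(1 + t))⁻¹ ^ (n + 2)) / t) (Ioi 0) ∧
    ∫ t in Ioi (0 : ℝ), ((√(1 + t))⁻¹ - (√(1 + t))⁻¹ ^ (n + 2)) / t
      ≤ Real.log (4 * ((n : ℝ) + 1))) := by
  induction n using Nat.twoStepInduction with
  | zero =>
    refine ⟨integrable_inv_sqrt_sub_sq.1, integrable_inv_sqrt_sub_sq.2.le.trans ?_⟩
    norm_num
  | one =>
    have h := integrable_inv_sqrt_sub_pow_step le_rfl (by simp)
    refine ⟨h.1, h.2.le.trans ?_⟩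
    have h8 : (2 : ℝ) ≤ Real.log 8 := by
      rw [show (8 : ℝ) = 2 ^ 3 by norm_num, Real.log_pow]
      have := Real.log_two_gt_d9
      norm_num; linarith
    norm_num
    exact h8
  | more n ih _ =>
    have h := integrable_inv_sqrt_sub_pow_step (by omega) ih.1
    refine ⟨h.1, h.2.le.trans ?_⟩
    have := two_div_le_log_div (n := n + 2) (by omega)
    have e1 : ((n + 2 : ℕ) : ℝ) - 1 = n + 1 := by push_cast; ring
    rw [e1] at this
    have h2 := ih.2
    push_cast at this ⊢
    linarith

lemma integral_inv_sqrt_sub_pow_le {n : ℕ} (hn : 1 ≤ n) :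
    IntegrableOn (fun t => ((√(1 + t))⁻¹ - (√(1 + t))⁻¹ ^ n) / t) (Ioi 0) ∧
    ∫ t in Ioi (0 : ℝ), ((√(1 + t))⁻¹ - (√(1 + t))⁻¹ ^ n) / t ≤ Real.log (4 * n) := by
  obtain rfl | ⟨m, rfl⟩ : n = 1 ∨ ∃ m, n = m + 2 := by
    rcases Nat.lt_or_ge n 2 with h | h
    · left; omega
    · exact Or.inr ⟨n - 2, by omega⟩
  · simpa using Real.log_nonneg (by norm_num)
  · obtain ⟨h1, h2⟩ := integral_inv_sqrt_sub_pow_le_aux m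
    refine ⟨h1, h2.trans (Real.log_le_log (by positivity) ?_)⟩
    push_cast
    linarith

lemma sub_log_le_integral {n : ℕ} (hn : 1 ≤ n) (x : ℝ) :
    IntegrableOn (fun t => ((√(1 + t))⁻¹ ^ n - (√(1 + t * Real.exp x))⁻¹) / t) (Ioi 0) ∧
    x - Real.log (4 * n)
      ≤ ∫ t in Ioi (0 : ℝ), ((√(1 + t))⁻¹ ^ n - (√(1 + t * Real.exp x))⁻¹) / t := by
  obtain ⟨h1, h2⟩ := integral_inv_sqrt_sub_pow_le hn
  obtain ⟨h3, h4⟩ := integrable_inv_sqrt_sub_inv_sqrt (Real.exp_pos x)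
  have heq : (fun t => ((√(1 + t))⁻¹ ^ n - (√(1 + t * Real.exp x))⁻¹) / t)
      = fun t => ((√(1 + t))⁻¹ - (√(1 + t * Real.exp x))⁻¹) / t
        - ((√(1 + t))⁻¹ - (√(1 + t))⁻¹ ^ n) / t := by
    funext t; ring
  rw [heq]
  refine ⟨h3.sub h1, ?_⟩
  rw [integral_sub h3 h1, h4, Real.log_exp]
  linarith

/-! ### Gaussian averages of ratios of quadratic forms -/

lemma integral_sq_mul_exp_neg_mul_sq {c : ℝ} (hc : 0 < c) :
    ∫ x : ℝ, x ^ 2 * Real.exp (-c * x ^ 2) = (2 * c)⁻¹ * √(Real.pi / c) := by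
  have h2 : Integrable fun x : ℝ => x ^ 2 * Real.exp (-c * x ^ 2) := by
    simpa using integrable_rpow_mul_exp_neg_mul_sq hc (s := 2) (by norm_num)
  have h1 := integrable_mul_exp_neg_mul_sq hc
  have h0 := integrable_exp_neg_mul_sq hc
  -- The integral of this derivative over the line vanishes, which ties the second moment to the
  -- Gaussian integral.
  have hder : ∀ x : ℝ, HasDerivAt (fun x => x * Real.exp (-c * x ^ 2))
      (Real.exp (-c * x ^ 2) - 2 * c * (x ^ 2 * Real.exp (-c * x ^ 2))) x := fun x => by
    have := ((hasDerivAt_id x).pow 2).const_mul (-c) |>.exp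
    refine ((hasDerivAt_id x).mul this).congr_deriv ?_
    simp
    ring
  have h := integral_eq_zero_of_hasDerivAt_of_integrable hder (h0.sub (h2.const_mul _)) h1
  rw [integral_sub h0 (h2.const_mul _), integral_const_mul, integral_gaussian] at h
  rw [inv_mul_eq_div, eq_div_iff (by positivity)]
  linarith

/-- The unnormalized Gaussian weight `exp (-‖y‖²)` in coordinates. -/
def gaussWeight (y : Fin n → ℝ) : ℝ := Real.exp (-∑ i, y i ^ 2)

lemma gaussWeight_pos (y : Fin n → ℝ) : 0 < gaussWeight y := Real.exp_pos _

lemma continuous_gaussWeight : Continuous (gaussWeight (n := n)) := by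
  unfold gaussWeight; fun_prop

lemma gaussWeight_eq_prod (y : Fin n → ℝ) :
    gaussWeight y = ∏ i, Real.exp (-1 * y i ^ 2) := by
  rw [gaussWeight, ← Finset.sum_neg_distrib, Real.exp_sum]
  simp

lemma integrable_gaussWeight : Integrable (gaussWeight (n := n)) := by
  simp_rw [funext gaussWeight_eq_prod]
  exact Integrable.fintype_prod fun _ => integrable_exp_neg_mul_sq one_pos

lemma integral_gaussWeight : ∫ y : Fin n → ℝ, gaussWeight y = √Real.pi ^ n := by
  simp_rw [gaussWeight_eq_prod]
  rw [integral_fintype_prod_volume_eq_pow (fun x : ℝ => Real.exp (-1 * x ^ 2)), integral_gaussian]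
  simp

lemma integral_gaussWeight_pos : 0 < ∫ y : Fin n → ℝ, gaussWeight y := by
  rw [integral_gaussWeight]; positivity

/-- The density in `t` whose integral is the `i`-th coordinate of the expectation of
`(bᵢ yᵢ² / ∑ⱼ bⱼ yⱼ²)ᵢ` for a Gaussian vector `y`. -/
def ratioDensity (b : Fin n → ℝ) (i : Fin n) (t : ℝ) : ℝ :=
  b i / (2 * (1 + t * b i)) * ∏ j, (√(1 + t * b j))⁻¹

lemma integral_sq_mul_exp_mul_gaussWeight {b : Fin n → ℝ} (hb : ∀ j, 0 < b j) (i : Fin n)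
    {t : ℝ} (ht : 0 < t) :
    ∫ y : Fin n → ℝ, b i * y i ^ 2 * Real.exp (-t * ∑ j, b j * y j ^ 2) * gaussWeight y
      = √Real.pi ^ n * ratioDensity b i t := by
  have hc : ∀ j, 0 < 1 + t * b j := fun j => by have := hb j; positivity
  have heq : ∀ y : Fin n → ℝ,
      b i * y i ^ 2 * Real.exp (-t * ∑ j, b j * y j ^ 2) * gaussWeight y
      = b i * ∏ j, ((if j = i then y j ^ 2 else 1) * Real.exp (-(1 + t * b j) * y j ^ 2)) := by
    intro y
    rw [Finset.prod_mul_distrib, Finset.prod_ite_eq' , if_pos (Finset.mem_univ i),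
      ← Real.exp_sum, gaussWeight, mul_assoc (b i * _), ← Real.exp_add, Finset.mul_sum,
      ← Finset.sum_neg_distrib, ← Finset.sum_add_distrib, mul_assoc]
    congr 4
    funext j
    ring
  simp_rw [heq]
  rw [integral_const_mul, integral_fintype_prod_volume_eq_prod
    (fun j (x : ℝ) => (if j = i then x ^ 2 else 1) * Real.exp (-(1 + t * b j) * x ^ 2))]
  have hj : ∀ j, ∫ x : ℝ, (if j = i then x ^ 2 else 1) * Real.exp (-(1 + t * b j) * x ^ 2)
      = (if j = i then (2 * (1 + t * b j))⁻¹ else 1) * (√Real.pi * (√(1 + t * b j))⁻¹) := by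
    intro j
    have hs : √(Real.pi / (1 + t * b j)) = √Real.pi * (√(1 + t * b j))⁻¹ := by
      rw [Real.sqrt_div Real.pi_pos.le, div_eq_mul_inv]
    split_ifs
    · rw [integral_sq_mul_exp_neg_mul_sq (hc j), hs]
    · simp_rw [one_mul]
      rw [integral_gaussian, hs]
  simp_rw [hj]
  rw [Finset.prod_mul_distrib, Finset.prod_ite_eq', if_pos (Finset.mem_univ i),
    Finset.prod_mul_distrib, Finset.prod_const, Finset.card_univ, Fintype.card_fin, ratioDensity]
  ring

/-- The `i`-th relative contribution to the quadratic form `∑ⱼ bⱼ yⱼ²`. -/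
def ratio (b : Fin n → ℝ) (i : Fin n) (y : Fin n → ℝ) : ℝ := b i * y i ^ 2 / ∑ j, b j * y j ^ 2

lemma ratio_nonneg {b : Fin n → ℝ} (hb : ∀ j, 0 < b j) (i : Fin n) (y : Fin n → ℝ) :
    0 ≤ ratio b i y :=
  div_nonneg (mul_nonneg (hb i).le (sq_nonneg _))
    (Finset.sum_nonneg fun j _ => mul_nonneg (hb j).le (sq_nonneg _))

lemma ratio_le_one {b : Fin n → ℝ} (hb : ∀ j, 0 < b j) (i : Fin n) (y : Fin n → ℝ) :
    ratio b i y ≤ 1 := by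
  have h : ∀ j ∈ Finset.univ, 0 ≤ b j * y j ^ 2 := fun j _ => mul_nonneg (hb j).le (sq_nonneg _)
  exact div_le_one_of_le₀ (Finset.single_le_sum h (Finset.mem_univ i)) (Finset.sum_nonneg h)

lemma measurable_ratio (b : Fin n → ℝ) (i : Fin n) : Measurable (ratio b i) := by
  unfold ratio; fun_prop

lemma integrable_ratio_mul_gaussWeight {b : Fin n → ℝ} (hb : ∀ j, 0 < b j) (i : Fin n) :
    Integrable fun y => ratio b i y * gaussWeight y := by
  refine integrable_gaussWeight.mono'
    ((measurable_ratio b i).mul continuous_gaussWeight.measurable).aestronglyMeasurable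
    (.of_forall fun y => ?_)
  rw [Real.norm_of_nonneg (mul_nonneg (ratio_nonneg hb i y) (gaussWeight_pos y).le)]
  exact mul_le_of_le_one_left (gaussWeight_pos y).le (ratio_le_one hb i y)

lemma integral_exp_quadratic {b : Fin n → ℝ} (hb : ∀ j, 0 < b j) (i : Fin n) (y : Fin n → ℝ) :
    IntegrableOn (fun t : ℝ => b i * y i ^ 2 * Real.exp (-t * ∑ j, b j * y j ^ 2) * gaussWeight y)
      (Ioi 0) ∧
    ∫ t in Ioi (0 : ℝ), b i * y i ^ 2 * Real.exp (-t * ∑ j, b j * y j ^ 2) * gaussWeight y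
      = ratio b i y * gaussWeight y := by
  have h : ∀ j ∈ Finset.univ, 0 ≤ b j * y j ^ 2 := fun j _ => mul_nonneg (hb j).le (sq_nonneg _)
  -- When the quadratic form vanishes, so does its i-th term, and both sides are 0 under the
  -- convention x / 0 = 0.
  rcases (Finset.sum_nonneg h).eq_or_lt with h0 | h0
  · have hi : b i * y i ^ 2 = 0 :=
      (Finset.sum_eq_zero_iff_of_nonneg h).1 h0.symm i (Finset.mem_univ i)
    simp [hi, ratio]
  · set s := ∑ j, b j * y j ^ 2
    have e : ∀ t : ℝ, b i * y i ^ 2 * Real.exp (-t * s) * gaussWeight y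
        = b i * y i ^ 2 * gaussWeight y * Real.exp (-s * t) := fun t => by
      rw [show -t * s = -s * t by ring]; ring
    simp_rw [e]
    refine ⟨(exp_neg_integrableOn_Ioi 0 h0).const_mul _, ?_⟩
    rw [integral_const_mul, integral_exp_mul_Ioi (neg_neg_of_pos h0), ratio]
    simp
    ring

lemma integrable_exp_quadratic_prod {b : Fin n → ℝ} (hb : ∀ j, 0 < b j) (i : Fin n) :
    Integrable (Function.uncurry fun (y : Fin n → ℝ) (t : ℝ) =>
      b i * y i ^ 2 * Real.exp (-t * ∑ j, b j * y j ^ 2) * gaussWeight y)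
      (volume.prod (volume.restrict (Ioi 0))) := by
  have hm : Measurable (Function.uncurry fun (y : Fin n → ℝ) (t : ℝ) =>
      b i * y i ^ 2 * Real.exp (-t * ∑ j, b j * y j ^ 2) * gaussWeight y) := by
    unfold Function.uncurry gaussWeight; fun_prop
  rw [integrable_prod_iff hm.aestronglyMeasurable]
  refine ⟨.of_forall fun y => (integral_exp_quadratic hb i y).1, ?_⟩
  refine (integrable_ratio_mul_gaussWeight hb i).congr (.of_forall fun y => ?_)
  simp only [Function.uncurry_apply_pair]
  rw [← (integral_exp_quadratic hb i y).2]
  refine integral_congr_ae (.of_forall fun t => ?_)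
  have h1 := mul_nonneg (hb i).le (sq_nonneg (y i))
  have h2 := gaussWeight_pos y
  exact (Real.norm_of_nonneg (by positivity)).symm

/-- Writing 1/q = ∫₀^∞ e^(-tq) dt for the denominator and exchanging integrals leaves, for each t, a
Gaussian integral that factors over coordinates. -/
lemma integral_ratio_mul_gaussWeight {b : Fin n → ℝ} (hb : ∀ j, 0 < b j) (i : Fin n) :
    IntegrableOn (ratioDensity b i) (Ioi 0) ∧
    ∫ y, ratio b i y * gaussWeight y
      = (∫ y : Fin n → ℝ, gaussWeight y) * ∫ t in Ioi (0 : ℝ), ratioDensity b i t := by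
  have hI := integrable_exp_quadratic_prod hb i
  have hpi : (0 : ℝ) < √Real.pi ^ n := by positivity
  constructor
  · have h := (hI.integral_prod_right).const_mul (√Real.pi ^ n)⁻¹
    refine IntegrableOn.congr_fun (f := _) h (fun t ht => ?_) measurableSet_Ioi
    simp only [Function.uncurry_apply_pair]
    rw [integral_sq_mul_exp_mul_gaussWeight hb i ht, inv_mul_cancel_left₀ hpi.ne']
  · simp_rw [← (integral_exp_quadratic hb i _).2]
    rw [integral_integral_swap hI, integral_gaussWeight, ← integral_const_mul]
    exact setIntegral_congr_fun measurableSet_Ioi fun t ht =>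
      integral_sq_mul_exp_mul_gaussWeight hb i ht

/-- The ratios sum to 1 away from the origin, a null set. This is the statement that the average
projection has trace 1. -/
lemma sum_integral_ratioDensity (hn : 1 ≤ n) {b : Fin n → ℝ} (hb : ∀ j, 0 < b j) :
    ∑ i, ∫ t in Ioi (0 : ℝ), ratioDensity b i t = 1 := by
  have : Nonempty (Fin n) := ⟨⟨0, hn⟩⟩
  have hZ := integral_gaussWeight_pos (n := n)
  refine mul_left_cancel₀ hZ.ne' ?_
  rw [Finset.mul_sum, mul_one]
  simp_rw [← (integral_ratio_mul_gaussWeight hb _).2]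
  rw [← integral_finsetSum _ fun i _ => integrable_ratio_mul_gaussWeight hb i]
  refine integral_congr_ae ?_
  filter_upwards [compl_mem_ae_iff.2 (measure_singleton (0 : Fin n → ℝ))] with y hy
  have hy0 : y ≠ 0 := hy
  obtain ⟨k, hk⟩ := Function.ne_iff.1 hy0
  have hs : 0 < ∑ j, b j * y j ^ 2 :=
    Finset.sum_pos' (fun j _ => mul_nonneg (hb j).le (sq_nonneg _))
      ⟨k, Finset.mem_univ k, mul_pos (hb k) (sq_pos_of_ne_zero hk)⟩
  simp only [ratio]
  rw [← Finset.sum_mul, ← Finset.sum_div, div_self hs.ne', one_mul]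

/-- Mixed terms integrate to zero by symmetry. -/
lemma integral_mixed_eq_zero (b : Fin n → ℝ) {i j : Fin n} (hij : i ≠ j) (c : ℝ) :
    ∫ y : Fin n → ℝ, c * y i * y j / (∑ k, b k * y k ^ 2) * gaussWeight y = 0 := by
  let e : (Fin n → ℝ) ≃ᵐ (Fin n → ℝ) := MeasurableEquiv.piCongrRight fun k =>
    if k = i then MeasurableEquiv.neg ℝ else MeasurableEquiv.refl ℝ
  have he : ∀ y k, e y k = if k = i then - y k else y k := fun y k => by
    change (if k = i then MeasurableEquiv.neg ℝ else MeasurableEquiv.refl ℝ) (y k) = _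
    split_ifs <;> rfl
  have hmp : MeasurePreserving e := by
    refine volume_preserving_pi (f := fun k => ⇑(if k = i then MeasurableEquiv.neg ℝ
      else MeasurableEquiv.refl ℝ)) fun k => ?_
    split_ifs
    · exact Measure.measurePreserving_neg volume
    · exact MeasurePreserving.id _
  have hsq : ∀ y k, e y k ^ 2 = y k ^ 2 := fun y k => by
    rw [he]; split_ifs <;> simp
  have h := hmp.integral_comp' fun y => c * y i * y j / (∑ k, b k * y k ^ 2) * gaussWeight y
  simp only [gaussWeight, hsq] at h
  simp only [he, if_pos, if_neg hij.symm] at h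
  simp only [gaussWeight]
  have e2 : ∀ y : Fin n → ℝ, c * -y i * y j / (∑ k, b k * y k ^ 2) * Real.exp (-∑ k, y k ^ 2)
      = -(c * y i * y j / (∑ k, b k * y k ^ 2) * Real.exp (-∑ k, y k ^ 2)) := fun y => by ring
  simp_rw [e2] at h
  rw [integral_neg] at h
  linarith

/-- By |yᵢ yⱼ| ≤ (yᵢ² + yⱼ²)/2, a mixed term is dominated by two diagonal ratios. -/
lemma integrable_mixed {b : Fin n → ℝ} (hb : ∀ j, 0 < b j) (i j : Fin n) (c : ℝ) :
    Integrable fun y : Fin n → ℝ => c * y i * y j / (∑ k, b k * y k ^ 2) * gaussWeight y := by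
  refine (((integrable_ratio_mul_gaussWeight hb i).const_mul (|c| / (2 * b i))).add
    ((integrable_ratio_mul_gaussWeight hb j).const_mul (|c| / (2 * b j)))).mono'
    (Measurable.aestronglyMeasurable (by unfold gaussWeight; fun_prop)) (.of_forall fun y => ?_)
  have hS : 0 ≤ ∑ k, b k * y k ^ 2 :=
    Finset.sum_nonneg fun j _ => mul_nonneg (hb j).le (sq_nonneg _)
  have hi := hb i
  have hj := hb j
  have e : |c| / (2 * b i) * (ratio b i y * gaussWeight y)
      + |c| / (2 * b j) * (ratio b j y * gaussWeight y)
      = |c| * ((y i ^ 2 + y j ^ 2) / 2) / (∑ k, b k * y k ^ 2) * gaussWeight y := by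
    unfold ratio
    field_simp
  rw [Pi.add_apply, e, norm_mul, norm_div, Real.norm_of_nonneg (gaussWeight_pos y).le,
    Real.norm_of_nonneg hS, mul_assoc, norm_mul, norm_mul, Real.norm_eq_abs, Real.norm_eq_abs,
    Real.norm_eq_abs]
  gcongr
  · exact (gaussWeight_pos y).le
  · rw [← sq_abs (y i), ← sq_abs (y j)]
    linarith [two_mul_le_add_sq |y i| |y j|]

/-! ### The average projection in the eigenbasis -/

/-- Integration of a positively homogeneous function of degree zero against the Gaussian weight
reduces to the uniform distribution on the sphere. -/
lemma integral_mul_exp_neg_norm_sq (hn : 1 ≤ n) (f : EuclideanSpace ℝ (Fin n) → ℝ)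
    (hf : ∀ (r : ℝ) x, 0 < r → f (r • x) = f x) :
    ∫ x, f x * Real.exp (-‖x‖ ^ 2) =
      (∫ u : Metric.sphere (0 : EuclideanSpace ℝ (Fin n)) 1, f u ∂(uniformSphere n)) *
        ∫ x : EuclideanSpace ℝ (Fin n), Real.exp (-‖x‖ ^ 2) := by
  have : Nonempty (Fin n) := ⟨⟨0, hn⟩⟩
  set S := (volume : Measure (EuclideanSpace ℝ (Fin n))).toSphere with hS
  set ν := Measure.volumeIoiPow (Module.finrank ℝ (EuclideanSpace ℝ (Fin n)) - 1)
  have key : ∀ g : EuclideanSpace ℝ (Fin n) → ℝ, (∀ (r : ℝ) x, 0 < r → g (r • x) = g x) →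
      ∫ x, g x * Real.exp (-‖x‖ ^ 2)
        = (∫ u, g u ∂S) * ∫ r : Ioi (0 : ℝ), Real.exp (-(r : ℝ) ^ 2) ∂ν := by
    intro g hg
    have h0 := integral_subtype_comap (μ := volume)
      (measurableSet_singleton (0 : EuclideanSpace ℝ (Fin n))).compl
      (fun x => g x * Real.exp (-‖x‖ ^ 2))
    rw [restrict_compl_singleton] at h0
    rw [← h0, ← integral_prod_mul (μ := S) (ν := ν)
      (fun u : Metric.sphere (0 : EuclideanSpace ℝ (Fin n)) 1 => g u)
      (fun r : Ioi (0 : ℝ) => Real.exp (-(r : ℝ) ^ 2)),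
      ← ((volume : Measure (EuclideanSpace ℝ (Fin n))).measurePreserving_homeomorphUnitSphereProd
        ).integral_comp (Homeomorph.measurableEmbedding _)]
    refine integral_congr_ae (.of_forall fun x => ?_)
    have hx : 0 < ‖(x : EuclideanSpace ℝ (Fin n))‖ := norm_pos_iff.2 x.2
    simp only [homeomorphUnitSphereProd_apply_fst_coe, homeomorphUnitSphereProd_apply_snd_coe]
    rw [hg _ _ (inv_pos.2 hx)]
  -- The constant function 1 identifies the radial integral as the total Gaussian mass divided by
  -- the surface measure of the sphere, so it never has to be computed.
  have h1 := key (fun _ => 1) fun _ _ _ => rfl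
  simp only [one_mul, integral_const, smul_eq_mul, mul_one] at h1
  have hS0 : S.real univ ≠ 0 := by
    rw [measureReal_ne_zero_iff]
    exact mt Measure.measure_univ_eq_zero.1 (Measure.toSphere_ne_zero _)
  rw [key f hf, h1, uniformSphere, integral_smul_measure, ENNReal.toReal_inv, ← hS,
    smul_eq_mul]
  change _ = (S.real univ)⁻¹ * _ * _
  field_simp

lemma integral_comp_coords (u : OrthonormalBasis (Fin n) ℝ (EuclideanSpace ℝ (Fin n)))
    (F : (Fin n → ℝ) → ℝ) :
    ∫ x, F (fun i => inner ℝ (u i) x) = ∫ y, F y := by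
  have h := ((EuclideanSpace.volume_preserving_symm_measurableEquiv_toLp (Fin n)).comp
    u.measurePreserving_repr).integral_comp
    ((MeasurableEquiv.toLp 2 (Fin n → ℝ)).symm.measurableEmbedding.comp
      u.repr.toHomeomorph.measurableEmbedding) F
  rw [← h]
  refine integral_congr_ae (.of_forall fun x => ?_)
  simp only [Function.comp_apply]
  congr 1
  funext i
  exact (u.repr_apply_apply x i).symm

lemma toOp_exp_smul_eigenvectorBasis {Y : Matrix (Fin n) (Fin n) ℝ} (hY : Y.IsHermitian) (c : ℝ)
    (i : Fin n) : toOp (NormedSpace.exp (c • Y)) (hY.eigenvectorBasis i)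
      = Real.exp (c * hY.eigenvalues i) • hY.eigenvectorBasis i := by
  set U : Matrix (Fin n) (Fin n) ℝ := (hY.eigenvectorUnitary).1 with hU
  have hUu : IsUnit U := (Unitary.toUnits hY.eigenvectorUnitary).isUnit
  have hUdet : IsUnit U.det := (Matrix.isUnit_iff_isUnit_det U).1 hUu
  have h1 : Y * U = U * Matrix.diagonal hY.eigenvalues := by
    ext a k
    rw [Matrix.mul_diagonal]
    have := congrFun (hY.mulVec_eigenvectorBasis k) a
    simp only [Pi.smul_apply, smul_eq_mul] at this
    rw [hU, Matrix.IsHermitian.eigenvectorUnitary_apply, mul_comm, ← this]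
    rfl
  have h2 : c • Y = U * Matrix.diagonal (fun k => c * hY.eigenvalues k) * U⁻¹ := by
    have e : Matrix.diagonal (fun k => c * hY.eigenvalues k)
        = c • Matrix.diagonal hY.eigenvalues := by
      rw [← Matrix.diagonal_smul]; rfl
    rw [e, Matrix.mul_smul, ← h1, Matrix.smul_mul, Matrix.mul_nonsing_inv_cancel_right _ _ hUdet]
  have h3 : NormedSpace.exp (c • Y) * U
      = U * Matrix.diagonal (fun k => Real.exp (c * hY.eigenvalues k)) := by
    rw [h2, Matrix.exp_conj _ _ hUu, Matrix.nonsing_inv_mul_cancel_right _ _ hUdet,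
      Matrix.exp_diagonal]
    congr 2
    funext k
    rw [Pi.coe_exp, Real.exp_eq_exp_ℝ]
  ext1 a
  have h4 := congrFun (congrFun h3 a) i
  rw [Matrix.mul_diagonal, hU, Matrix.IsHermitian.eigenvectorUnitary_apply, mul_comm] at h4
  exact h4

lemma isHermitian_exp_smul {Y : Matrix (Fin n) (Fin n) ℝ} (hY : Y.IsHermitian) (c : ℝ) :
    (NormedSpace.exp (c • Y)).IsHermitian :=
  Matrix.IsHermitian.exp (by
    rw [Matrix.IsHermitian, Matrix.conjTranspose_smul, hY.eq]; simp)

/-- The quadratic form of the matrix exponential in eigencoordinates. -/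
lemma dotProduct_exp_mulVec {Y : Matrix (Fin n) (Fin n) ℝ} (hY : Y.IsHermitian)
    (x : EuclideanSpace ℝ (Fin n)) :
    (fun k => x k) ⬝ᵥ (NormedSpace.exp Y *ᵥ fun k => x k)
      = ∑ i, Real.exp (hY.eigenvalues i) * inner ℝ (hY.eigenvectorBasis i) x ^ 2 := by
  have h1 := Matrix.inner_toEuclideanCLM (NormedSpace.exp ((1 : ℝ) • Y)) x x
  have h2 := inner_self_apply_eq_sum (A := toOp (NormedSpace.exp ((1 : ℝ) • Y)))
    (toOp_exp_smul_eigenvectorBasis hY 1) (toOp_symm (isHermitian_exp_smul hY 1)) x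
  rw [h1] at h2
  simpa using h2

lemma frobInner_randProj {Y : Matrix (Fin n) (Fin n) ℝ} (hY : Y.IsHermitian)
    (D : Matrix (Fin n) (Fin n) ℝ) (x : EuclideanSpace ℝ (Fin n)) :
    frobInner D (randProj (fun k => x k) Y) =
      ∑ i, ∑ j, Real.exp (1 / 2 * hY.eigenvalues i) * Real.exp (1 / 2 * hY.eigenvalues j) *
        inner ℝ (hY.eigenvectorBasis i) (toOp D (hY.eigenvectorBasis j)) *
        inner ℝ (hY.eigenvectorBasis i) x * inner ℝ (hY.eigenvectorBasis j) x /
        ∑ k, Real.exp (hY.eigenvalues k) * inner ℝ (hY.eigenvectorBasis k) x ^ 2 := by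
  set u := hY.eigenvectorBasis
  set W := NormedSpace.exp ((1 / 2 : ℝ) • Y)
  have hW : W.IsHermitian := isHermitian_exp_smul hY _
  have hWx : toOp W x = ∑ i, (Real.exp (1 / 2 * hY.eigenvalues i) * inner ℝ (u i) x) • u i := by
    conv_lhs => rw [← u.sum_repr' x]
    rw [map_sum]
    refine Finset.sum_congr rfl fun i _ => ?_
    rw [map_smul, toOp_exp_smul_eigenvectorBasis hY, smul_smul, mul_comm]
  have h1 : frobInner D (randProj (fun k => x k) Y) =
      inner ℝ (toOp W x) (toOp D (toOp W x)) /
        ((fun k => x k) ⬝ᵥ (NormedSpace.exp Y *ᵥ fun k => x k)) := by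
    have e : (fun k => x k) ᵥ* W = W *ᵥ fun k => x k := by
      rw [← Matrix.mulVec_transpose, show Wᵀ = W by simpa using hW.eq]
    rw [frobInner, randProj, Matrix.mul_smul, Matrix.trace_smul, smul_eq_mul, inv_mul_eq_div,
      Matrix.mul_vecMulVec, Matrix.vecMulVec_mul, e, Matrix.mul_vecMulVec, Matrix.trace_vecMulVec,
      Matrix.inner_toEuclideanCLM, Matrix.mulVec_transpose, ← Matrix.dotProduct_mulVec]
    rfl
  rw [h1, dotProduct_exp_mulVec hY, hWx, map_sum, sum_inner, Finset.sum_div]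
  refine Finset.sum_congr rfl fun i _ => ?_
  rw [inner_sum, Finset.sum_div]
  refine Finset.sum_congr rfl fun j _ => ?_
  rw [map_smul, inner_smul_left, inner_smul_right]
  simp only [conj_trivial]
  ring

lemma integrable_randProj_apply (hn : 1 ≤ n) {Y : Matrix (Fin n) (Fin n) ℝ} (hY : Y.IsHermitian)
    (i j : Fin n) :
    Integrable (fun u : Metric.sphere (0 : EuclideanSpace ℝ (Fin n)) 1 =>
      randProj (fun k => (u : EuclideanSpace ℝ (Fin n)) k) Y i j) (uniformSphere n) := by
  have : Nonempty (Fin n) := ⟨⟨0, hn⟩⟩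
  refine Integrable.smul_measure ?_ (ENNReal.inv_ne_top.2
    (mt Measure.measure_univ_eq_zero.1 (Measure.toSphere_ne_zero _)))
  refine Continuous.integrable_of_hasCompactSupport ?_ (HasCompactSupport.of_compactSpace _)
  have hc : Continuous fun u : Metric.sphere (0 : EuclideanSpace ℝ (Fin n)) 1 =>
      (fun k => (u : EuclideanSpace ℝ (Fin n)) k) := by fun_prop
  simp only [randProj, Matrix.smul_apply, smul_eq_mul]
  refine Continuous.mul (Continuous.inv₀ (hc.dotProduct (continuous_const.matrix_mulVec hc)) ?_)
    (((continuous_const.matrix_mul (hc.matrix_vecMulVec hc)).matrix_mul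
      continuous_const).matrix_elem i j)
  intro u
  rw [dotProduct_exp_mulVec hY]
  have hu : ∑ i, inner ℝ (hY.eigenvectorBasis i) (u : EuclideanSpace ℝ (Fin n)) ^ 2 = 1 := by
    have := hY.eigenvectorBasis.sum_sq_norm_inner_right (u : EuclideanSpace ℝ (Fin n))
    simpa using this
  intro h0
  rw [Finset.sum_eq_zero_iff_of_nonneg fun i _ => by positivity] at h0
  refine zero_ne_one ((Finset.sum_eq_zero fun i hi => ?_).symm.trans hu)
  exact (mul_eq_zero.1 (h0 i hi)).resolve_left (Real.exp_pos _).ne'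

lemma frobInner_avgProj_eq_integral (hn : 1 ≤ n) {Y : Matrix (Fin n) (Fin n) ℝ} (hY : Y.IsHermitian)
    (D : Matrix (Fin n) (Fin n) ℝ) :
    frobInner D (avgProj Y) = ∫ u : Metric.sphere (0 : EuclideanSpace ℝ (Fin n)) 1,
      frobInner D (randProj (fun k => (u : EuclideanSpace ℝ (Fin n)) k) Y) ∂(uniformSphere n) := by
  simp only [frobInner, Matrix.trace, Matrix.diag, Matrix.mul_apply, Matrix.transpose_apply,
    avgProj, Matrix.of_apply]
  rw [integral_finsetSum _ fun i _ => integrable_finsetSum _ fun j _ =>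
    (integrable_randProj_apply hn hY j i).const_mul _]
  refine Finset.sum_congr rfl fun i _ => ?_
  rw [integral_finsetSum _ fun j _ => (integrable_randProj_apply hn hY j i).const_mul _]
  exact Finset.sum_congr rfl fun j _ => (integral_const_mul _ _).symm

/-- The average mirror projection in the eigenbasis. -/
lemma frobInner_avgProj (hn : 1 ≤ n) {Y : Matrix (Fin n) (Fin n) ℝ} (hY : Y.IsHermitian)
    (D : Matrix (Fin n) (Fin n) ℝ) :
    frobInner D (avgProj Y) = ∑ i, (∫ t in Ioi (0 : ℝ),
        ratioDensity (fun j => Real.exp (hY.eigenvalues j)) i t) *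
      inner ℝ (hY.eigenvectorBasis i) (toOp D (hY.eigenvectorBasis i)) := by
  set u := hY.eigenvectorBasis
  set b := fun j => Real.exp (hY.eigenvalues j) with hbdef
  have hb : ∀ j, 0 < b j := fun j => Real.exp_pos _
  have hZ : (∫ x : EuclideanSpace ℝ (Fin n), Real.exp (-‖x‖ ^ 2))
      = ∫ y : Fin n → ℝ, gaussWeight y := by
    rw [← integral_comp_coords u]
    refine integral_congr_ae (.of_forall fun x => ?_)
    simp only [gaussWeight]
    rw [← u.sum_sq_norm_inner_right x]
    simp
  have hZ0 := (integral_gaussWeight_pos (n := n)).ne'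
  -- The projection is unchanged under scaling of x, so the sphere average is a Gaussian average. In
  -- eigencoordinates the off-diagonal terms vanish by reflection and the diagonal ones are `ratio`
  -- integrals.
  have h1 := integral_mul_exp_neg_norm_sq hn
    (fun x => frobInner D (randProj (fun k => x k) Y)) (fun r x hr => by
      simp only [frobInner_randProj hY]
      refine Finset.sum_congr rfl fun i _ => Finset.sum_congr rfl fun j _ => ?_
      simp only [inner_smul_right, mul_pow]
      have e : ∀ k, Real.exp (hY.eigenvalues k) * (r ^ 2 * inner ℝ (hY.eigenvectorBasis k) x ^ 2)
        = r ^ 2 * (Real.exp (hY.eigenvalues k) * inner ℝ (hY.eigenvectorBasis k) x ^ 2) :=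
        fun k => by ring
      simp_rw [e]
      rw [← Finset.mul_sum, ← mul_div_mul_left _ (∑ k, _) (pow_ne_zero 2 hr.ne')]
      congr 1
      ring)
  rw [hZ, ← frobInner_avgProj_eq_integral hn hY] at h1
  set c : Fin n → Fin n → ℝ := fun i j =>
    Real.exp (1 / 2 * hY.eigenvalues i) * Real.exp (1 / 2 * hY.eigenvalues j) *
        inner ℝ (u i) (toOp D (u j)) with hc
  have h2 : ∫ x : EuclideanSpace ℝ (Fin n),
      frobInner D (randProj (fun k => x k) Y) * Real.exp (-‖x‖ ^ 2)
      = ∫ y : Fin n → ℝ, ∑ i, ∑ j, c i j * y i * y j / (∑ k, b k * y k ^ 2) * gaussWeight y := by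
    rw [← integral_comp_coords u]
    refine integral_congr_ae (.of_forall fun x => ?_)
    simp only [gaussWeight]
    rw [frobInner_randProj hY, ← u.sum_sq_norm_inner_right x]
    simp only [Finset.sum_mul, Real.norm_eq_abs, sq_abs]
    rfl
  rw [h2, integral_finsetSum _ fun i _ => integrable_finsetSum _ fun j _ =>
    integrable_mixed hb i j (c i j)] at h1
  refine mul_right_cancel₀ hZ0 ?_
  rw [← h1, Finset.sum_mul]
  refine Finset.sum_congr rfl fun i _ => ?_
  rw [integral_finsetSum _ fun j _ => integrable_mixed hb i j (c i j),
    Finset.sum_eq_single i (fun j _ hj => integral_mixed_eq_zero b hj.symm _) (by simp)]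
  have h3 := (integral_ratio_mul_gaussWeight hb i).2
  have e : ∀ y : Fin n → ℝ, c i i * y i * y i / (∑ k, b k * y k ^ 2) * gaussWeight y
      = inner ℝ (u i) (toOp D (u i)) * (ratio b i y * gaussWeight y) := fun y => by
    have e2 : c i i = b i * inner ℝ (u i) (toOp D (u i)) := by
      rw [hc, hbdef]
      simp only [← Real.exp_add]
      ring_nf
    rw [e2, ratio]
    ring
  simp_rw [e]
  rw [integral_const_mul, h3]
  ring

/-! ### The potential and its smoothness -/

/-- The function `t ↦ det (1 + t e^A) ^ (-1/2)` in terms of the eigenvalues of `A`. -/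
def spectralWeight {A : Matrix (Fin n) (Fin n) ℝ} (hA : A.IsHermitian) (t : ℝ) : ℝ :=
  ∏ j, (√(1 + t * Real.exp (hA.eigenvalues j)))⁻¹

lemma spectralWeight_eq_exp {A : Matrix (Fin n) (Fin n) ℝ} (hA : A.IsHermitian) {t : ℝ}
    (ht : 0 < t) :
    spectralWeight hA t = Real.exp (-(∑ j, softplus t (hA.eigenvalues j)) / 2) := by
  rw [spectralWeight, neg_div, Finset.sum_div, ← Finset.sum_neg_distrib, Real.exp_sum]
  refine Finset.prod_congr rfl fun j _ => ?_
  have h := one_add_mul_exp_pos ht (hA.eigenvalues j)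
  rw [Real.exp_neg, softplus, Real.sqrt_eq_rpow, Real.rpow_def_of_pos h]
  ring_nf

/-- The coefficients of the average mirror projection in the eigenbasis. -/
def avgCoeff {A : Matrix (Fin n) (Fin n) ℝ} (hA : A.IsHermitian) (i : Fin n) : ℝ :=
  ∫ t in Ioi (0 : ℝ), ratioDensity (fun j => Real.exp (hA.eigenvalues j)) i t

lemma ratioDensity_exp_eigenvalues {A : Matrix (Fin n) (Fin n) ℝ} (hA : A.IsHermitian)
    (i : Fin n) {t : ℝ} (ht : 0 < t) :
    ratioDensity (fun j => Real.exp (hA.eigenvalues j)) i t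
      = spectralWeight hA t * logistic t (hA.eigenvalues i) / (2 * t) := by
  have h := one_add_mul_exp_pos ht (hA.eigenvalues i)
  rw [ratioDensity, logistic, spectralWeight]
  field_simp

lemma avgCoeff_nonneg {A : Matrix (Fin n) (Fin n) ℝ} (hA : A.IsHermitian) (i : Fin n) :
    0 ≤ avgCoeff hA i := by
  refine setIntegral_nonneg measurableSet_Ioi fun t ht => ?_
  have ht' : 0 < t := ht
  rw [ratioDensity_exp_eigenvalues hA i ht', spectralWeight_eq_exp hA ht']
  have := logistic_pos ht' (hA.eigenvalues i)
  positivity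

lemma sum_avgCoeff (hn : 1 ≤ n) {A : Matrix (Fin n) (Fin n) ℝ} (hA : A.IsHermitian) :
    ∑ i, avgCoeff hA i = 1 :=
  sum_integral_ratioDensity hn fun _ => Real.exp_pos _

/-- The pairing is a convex combination of the values ⟨uᵢ, D uᵢ⟩, each at most the operator norm in
absolute value. -/
lemma abs_frobInner_avgProj_le (hn : 1 ≤ n) {A : Matrix (Fin n) (Fin n) ℝ} (hA : A.IsHermitian)
    (D : Matrix (Fin n) (Fin n) ℝ) : |frobInner D (avgProj A)| ≤ opNorm D := by
  rw [frobInner_avgProj hn hA, ← mul_one (opNorm D), ← sum_avgCoeff hn hA, Finset.mul_sum]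
  refine (Finset.abs_sum_le_sum_abs _ _).trans (Finset.sum_le_sum fun i _ => ?_)
  have h := inner_toOp_le D (hA.eigenvectorBasis i)
  rw [OrthonormalBasis.norm_eq_one, one_pow, mul_one] at h
  change |avgCoeff hA i * _| ≤ _
  rw [abs_mul, abs_of_nonneg (avgCoeff_nonneg hA i), mul_comm]
  exact mul_le_mul_of_nonneg_right h (avgCoeff_nonneg hA i)

/-- The difference of potentials `∫₀^∞ (w_A(t) - w_B(t)) / t dt`, with `w` the spectral weight, is
at most `c`; phrased through an integrable majorant of the integrand. -/
def PotentialGapLE {A B : Matrix (Fin n) (Fin n) ℝ} (hA : A.IsHermitian) (hB : B.IsHermitian)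
    (c : ℝ) : Prop :=
  ∃ r : ℝ → ℝ, IntegrableOn r (Ioi 0) ∧
    (∀ t, 0 < t → (spectralWeight hA t - spectralWeight hB t) / t ≤ r t) ∧
    ∫ t in Ioi (0 : ℝ), r t ≤ c

lemma PotentialGapLE.refl {A : Matrix (Fin n) (Fin n) ℝ} (hA : A.IsHermitian) :
    PotentialGapLE hA hA 0 :=
  ⟨fun _ => 0, integrableOn_zero, fun t _ => by simp, by simp⟩

lemma PotentialGapLE.mono {A B : Matrix (Fin n) (Fin n) ℝ} {hA : A.IsHermitian}
    {hB : B.IsHermitian} {c d : ℝ} (h : PotentialGapLE hA hB c) (hcd : c ≤ d) :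
    PotentialGapLE hA hB d := by
  obtain ⟨r, h1, h2, h3⟩ := h
  exact ⟨r, h1, h2, h3.trans hcd⟩

lemma PotentialGapLE.trans {A B C : Matrix (Fin n) (Fin n) ℝ} {hA : A.IsHermitian}
    {hB : B.IsHermitian} {hC : C.IsHermitian} {c d : ℝ} (h : PotentialGapLE hA hB c)
    (h' : PotentialGapLE hB hC d) : PotentialGapLE hA hC (c + d) := by
  obtain ⟨r, h1, h2, h3⟩ := h
  obtain ⟨s, k1, k2, k3⟩ := h'
  refine ⟨fun t => r t + s t, h1.add k1, fun t ht => ?_, ?_⟩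
  · have := add_le_add (h2 t ht) (k2 t ht)
    rwa [← add_div, sub_add_sub_cancel] at this
  · rw [integral_add h1 k1]
    exact add_le_add h3 k3

/-- By eˣ ≥ 1 + x, w_A - w_B ≤ w_A δ/2 with δ the difference of softplus traces. Since w_A
σ(aᵢ)/(2t) is `ratioDensity`, bounding δ by logistic weights at A gives an integrable majorant whose
integral is expressed by `avgCoeff`. -/
lemma potentialGapLE_of_sum_softplus_le {A B : Matrix (Fin n) (Fin n) ℝ} (hA : A.IsHermitian)
    (hB : B.IsHermitian) (κ : Fin n → ℝ)
    (h : ∀ t, 0 < t → ∑ j, softplus t (hB.eigenvalues j) - ∑ i, softplus t (hA.eigenvalues i)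
      ≤ ∑ i, logistic t (hA.eigenvalues i) * κ i) :
    PotentialGapLE hA hB (∑ i, avgCoeff hA i * κ i) := by
  have hint : ∀ i, IntegrableOn
      (fun t => ratioDensity (fun j => Real.exp (hA.eigenvalues j)) i t * κ i) (Ioi 0) := fun i =>
    (integral_ratio_mul_gaussWeight (fun _ => Real.exp_pos _) i).1.mul_const _
  refine ⟨fun t => ∑ i, ratioDensity (fun j => Real.exp (hA.eigenvalues j)) i t * κ i,
    integrable_finsetSum _ fun i _ => hint i, fun t ht => ?_, ?_⟩
  · have hw : 0 < spectralWeight hA t := by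
      rw [spectralWeight_eq_exp hA ht]; exact Real.exp_pos _
    set δ := ∑ j, softplus t (hB.eigenvalues j) - ∑ i, softplus t (hA.eigenvalues i) with hδ
    have e : spectralWeight hB t = spectralWeight hA t * Real.exp (-δ / 2) := by
      rw [spectralWeight_eq_exp hA ht, spectralWeight_eq_exp hB ht, ← Real.exp_add, hδ]
      ring_nf
    have h1 : spectralWeight hA t - spectralWeight hB t ≤ spectralWeight hA t * (δ / 2) := by
      rw [e]
      have := mul_le_mul_of_nonneg_left (Real.add_one_le_exp (-δ / 2)) hw.le
      linarith
    have e2 : ∑ i, ratioDensity (fun j => Real.exp (hA.eigenvalues j)) i t * κ i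
        = spectralWeight hA t * ((∑ i, logistic t (hA.eigenvalues i) * κ i) / 2) / t := by
      rw [Finset.sum_div, Finset.mul_sum, Finset.sum_div]
      refine Finset.sum_congr rfl fun i _ => ?_
      rw [ratioDensity_exp_eigenvalues hA i ht]
      field_simp
    refine le_of_le_of_eq ?_ e2.symm
    refine div_le_div_of_nonneg_right (h1.trans ?_) ht.le
    have := h t ht
    gcongr
  · rw [integral_finsetSum _ fun i _ => hint i]
    refine (Finset.sum_congr rfl fun i _ => ?_).le
    exact integral_mul_const _ _

lemma sum_avgCoeff_mul (hn : 1 ≤ n) {A : Matrix (Fin n) (Fin n) ℝ} (hA : A.IsHermitian)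
    (D : Matrix (Fin n) (Fin n) ℝ) :
    ∑ i, avgCoeff hA i * inner ℝ (hA.eigenvectorBasis i) (toOp D (hA.eigenvectorBasis i))
      = frobInner D (avgProj A) :=
  (frobInner_avgProj hn hA D).symm

lemma exp_four_thirds_le : Real.exp (4 / 3) ≤ 4 := by
  have h : (4 : ℝ) / 3 ≤ Real.log 4 := by
    rw [show (4 : ℝ) = 2 ^ 2 by norm_num, Real.log_pow]
    have := Real.log_two_gt_d9
    norm_num
    linarith
  exact (Real.le_log_iff_exp_le (by norm_num)).1 h

/-- The Bregman bound yields (2 S_A + S_B) d²/4 with S the logistic sums, and S_B ≤ e^d S_A ≤ 4 S_A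
for d ≤ 4/3. The constant is (2 + 4)/4 = 3/2. -/
lemma potentialGapLE_of_opNorm_le (hn : 1 ≤ n) {A B : Matrix (Fin n) (Fin n) ℝ}
    (hA : A.IsHermitian) (hB : B.IsHermitian) (hd : opNorm (B - A) ≤ 4 / 3) :
    PotentialGapLE hA hB (frobInner (B - A) (avgProj A) + 3 / 2 * opNorm (B - A) ^ 2) := by
  set d := opNorm (B - A)
  have hd0 : 0 ≤ d := norm_nonneg _
  have key := potentialGapLE_of_sum_softplus_le hA hB
    (fun i => inner ℝ (hA.eigenvectorBasis i) (toOp (B - A) (hA.eigenvectorBasis i))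
      + 3 / 2 * d ^ 2) (fun t ht => ?_)
  · refine key.mono (le_of_eq ?_)
    simp_rw [mul_add]
    rw [Finset.sum_add_distrib, sum_avgCoeff_mul hn, ← Finset.sum_mul, sum_avgCoeff hn, one_mul]
  have h1 := sum_softplus_bregman_le (toOp_eigenvectorBasis hA) (toOp_eigenvectorBasis hB)
    (toOp_symm hA) (toOp_symm hB) ht
  have h2 := sum_logistic_le hA hB ht
  have hnorm : ∀ u : OrthonormalBasis (Fin n) ℝ (EuclideanSpace ℝ (Fin n)), ∀ i,
      ‖toOp (B - A) (u i)‖ ^ 2 ≤ d ^ 2 := fun u i => by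
    have := (toOp (B - A)).le_opNorm (u i)
    rw [OrthonormalBasis.norm_eq_one, mul_one] at this
    exact pow_le_pow_left₀ (norm_nonneg _) this 2
  simp only [toOp, ← map_sub] at h1 hnorm ⊢
  have h3 : ∑ i, logistic t (hA.eigenvalues i) *
      ‖Matrix.toEuclideanCLM (n := Fin n) (𝕜 := ℝ) (B - A) (hA.eigenvectorBasis i)‖ ^ 2
      ≤ (∑ i, logistic t (hA.eigenvalues i)) * d ^ 2 := by
    rw [Finset.sum_mul]
    exact Finset.sum_le_sum fun i _ =>
      mul_le_mul_of_nonneg_left (hnorm _ i) (logistic_pos ht _).le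
  have h4 : ∑ j, logistic t (hB.eigenvalues j) *
      ‖Matrix.toEuclideanCLM (n := Fin n) (𝕜 := ℝ) (B - A) (hB.eigenvectorBasis j)‖ ^ 2
      ≤ (∑ j, logistic t (hB.eigenvalues j)) * d ^ 2 := by
    rw [Finset.sum_mul]
    exact Finset.sum_le_sum fun i _ =>
      mul_le_mul_of_nonneg_left (hnorm _ i) (logistic_pos ht _).le
  have hs : 0 ≤ ∑ i, logistic t (hA.eigenvalues i) :=
    Finset.sum_nonneg fun i _ => (logistic_pos ht _).le
  have h5 : ∑ j, logistic t (hB.eigenvalues j) ≤ 4 * ∑ i, logistic t (hA.eigenvalues i) :=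
    h2.trans (mul_le_mul_of_nonneg_right ((Real.exp_le_exp.2 hd).trans exp_four_thirds_le) hs)
  have h6 := mul_le_mul_of_nonneg_right h5 (sq_nonneg d)
  simp_rw [mul_add]
  rw [Finset.sum_add_distrib, ← Finset.sum_mul]
  linarith

lemma opNorm_smul (c : ℝ) (D : Matrix (Fin n) (Fin n) ℝ) : opNorm (c • D) = |c| * opNorm D := by
  rw [opNorm, map_smul, norm_smul, Real.norm_eq_abs]; rfl

lemma frobInner_smul_left (c : ℝ) (D X : Matrix (Fin n) (Fin n) ℝ) :
    frobInner (c • D) X = c * frobInner D X := by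
  rw [frobInner, Matrix.transpose_smul, Matrix.smul_mul, Matrix.trace_smul]; rfl

/-- Smoothness of the potential with respect to the operator norm. -/
lemma potentialGapLE_opNorm (hn : 1 ≤ n) {A B : Matrix (Fin n) (Fin n) ℝ}
    (hA : A.IsHermitian) (hB : B.IsHermitian) :
    PotentialGapLE hA hB (frobInner (B - A) (avgProj A) + 3 / 2 * opNorm (B - A) ^ 2) := by
  -- Large steps are bisected at the midpoint; k bounds the depth of bisection.
  obtain ⟨k, hk⟩ : ∃ k : ℕ, opNorm (B - A) ≤ 4 / 3 * 2 ^ k := by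
    obtain ⟨k, hk⟩ := pow_unbounded_of_one_lt (opNorm (B - A)) (one_lt_two (α := ℝ))
    exact ⟨k, by have : (0 : ℝ) < 2 ^ k := by positivity
                 linarith⟩
  induction k generalizing A B with
  | zero => exact potentialGapLE_of_opNorm_le hn hA hB (by simpa using hk)
  | succ k ih =>
    rcases le_total (opNorm (B - A)) (4 / 3) with h | h
    · exact potentialGapLE_of_opNorm_le hn hA hB h
    have hM : ((1 / 2 : ℝ) • (A + B)).IsHermitian := by
      rw [Matrix.IsHermitian, Matrix.conjTranspose_smul, (hA.add hB).eq]; simp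
    have e1 : (1 / 2 : ℝ) • (A + B) - A = (1 / 2 : ℝ) • (B - A) := by module
    have e2 : B - (1 / 2 : ℝ) • (A + B) = (1 / 2 : ℝ) • (B - A) := by module
    have e3 : opNorm ((1 / 2 : ℝ) • (B - A)) = opNorm (B - A) / 2 := by
      rw [opNorm_smul, abs_of_pos (by norm_num)]; ring
    have hle : opNorm (B - A) / 2 ≤ 4 / 3 * 2 ^ k := by
      rw [pow_succ] at hk; linarith
    have h1 := ih hA hM (by rw [e1, e3]; exact hle)
    have h2 := ih hM hB (by rw [e2, e3]; exact hle)
    rw [e1] at h1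
    rw [e2] at h2
    refine (h1.trans h2).mono ?_
    rw [e3, frobInner_smul_left, frobInner_smul_left]
    -- With d = ‖B - A‖, replacing the midpoint projection by that of A costs at most d. The two
    -- half steps have quadratic terms totalling (3/4)d², which saves (3/4)d², and this covers d
    -- exactly when d ≥ 4/3. This explains the threshold.
    have h3 := neg_le_of_abs_le (abs_frobInner_avgProj_le hn hA (B - A))
    have h4 := le_of_abs_le (abs_frobInner_avgProj_le hn hM (B - A))
    nlinarith

/-- Smoothness of the potential along positive semidefinite directions. -/
lemma potentialGapLE_posSemidef (hn : 1 ≤ n) {A B G : Matrix (Fin n) (Fin n) ℝ}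
    (hA : A.IsHermitian) (hB : B.IsHermitian) {η : ℝ} (hη : 0 < η) (hη' : η ≤ 1 / 6)
    (hG : G.PosSemidef) (hG' : (1 - G).PosSemidef) (hBA : B - A = η • G) :
    PotentialGapLE hA hB ((1 + 3 * η) * (η * frobInner G (avgProj A))) := by
  have key := potentialGapLE_of_sum_softplus_le hA hB
    (fun i => (1 + 3 * η) *
      inner ℝ (hA.eigenvectorBasis i) (toOp (B - A) (hA.eigenvectorBasis i))) (fun t ht => ?_)
  · refine key.mono (le_of_eq ?_)
    rw [← frobInner_smul_left, ← hBA, ← sum_avgCoeff_mul hn hA, Finset.mul_sum]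
    exact Finset.sum_congr rfl fun i _ => by ring
  have hD : ∀ x : EuclideanSpace ℝ (Fin n),
      ‖toOp (B - A) x‖ ^ 2 ≤ η * inner ℝ x (toOp (B - A) x) := fun x => by
    have h := norm_toOp_sq_le_of_posSemidef hG hG' x
    have e : toOp (B - A) x = η • toOp G x := by
      rw [hBA]; simp [toOp]
    rw [e, norm_smul, mul_pow, inner_smul_right, Real.norm_eq_abs, sq_abs, sq, mul_assoc]
    gcongr
  have h1 := sum_softplus_sub_le (toOp_eigenvectorBasis hA) (toOp_eigenvectorBasis hB)
    (toOp_symm hA) ht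
  have h2 := sum_logistic_mul_sub_le (toOp_eigenvectorBasis hA) (toOp_eigenvectorBasis hB)
    (toOp_symm hA) (toOp_symm hB) ht
  have h3 : ∀ {M : Matrix (Fin n) (Fin n) ℝ} (hM : M.IsHermitian),
      ∑ i, logistic t (hM.eigenvalues i) * ‖toOp (B - A) (hM.eigenvectorBasis i)‖ ^ 2
      ≤ η * ∑ i, logistic t (hM.eigenvalues i) *
        inner ℝ (hM.eigenvectorBasis i) (toOp (B - A) (hM.eigenvectorBasis i)) := fun hM => by
    rw [Finset.mul_sum]
    refine Finset.sum_le_sum fun i _ => ?_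
    have := mul_le_mul_of_nonneg_left (hD (hM.eigenvectorBasis i))
      (logistic_pos ht (hM.eigenvalues i)).le
    linarith
  have hx : 0 ≤ ∑ i, logistic t (hA.eigenvalues i) *
        inner ℝ (hA.eigenvectorBasis i) (toOp (B - A) (hA.eigenvectorBasis i)) := by
    refine Finset.sum_nonneg fun i _ => mul_nonneg (logistic_pos ht _).le ?_
    exact nonneg_of_mul_nonneg_right ((sq_nonneg _).trans (hD _)) hη
  have h4 := h3 hA
  have h5 := h3 hB
  simp only [toOp, ← map_sub] at h1 h2 h4 h5 hx ⊢
  have e : ∑ i, logistic t (hA.eigenvalues i) * ((1 + 3 * η) *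
      inner ℝ (hA.eigenvectorBasis i)
        (Matrix.toEuclideanCLM (n := Fin n) (𝕜 := ℝ) (B - A) (hA.eigenvectorBasis i)))
      = (1 + 3 * η) * ∑ i, logistic t (hA.eigenvalues i) * inner ℝ (hA.eigenvectorBasis i)
        (Matrix.toEuclideanCLM (n := Fin n) (𝕜 := ℝ) (B - A) (hA.eigenvectorBasis i)) := by
    rw [Finset.mul_sum]
    exact Finset.sum_congr rfl fun i _ => by ring
  rw [e]
  refine h1.trans ?_
  -- With x and y the logistic-weighted traces of B - A at A and B, the bounds give y - x ≤ η(x +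
  -- y)/2, so (1 - η/2) y ≤ (1 + η/2) x. The latter is at most (1 - η/2)(1 + 3η) x, with slack (2η -
  -- (3/2)η²) x.
  refine le_of_mul_le_mul_left ?_ (show 0 < 1 - η / 2 by linarith)
  have h6 : 0 ≤ (2 * η - 3 / 2 * η ^ 2) * ∑ i, logistic t (hA.eigenvalues i) *
      inner ℝ (hA.eigenvectorBasis i)
        (Matrix.toEuclideanCLM (n := Fin n) (𝕜 := ℝ) (B - A) (hA.eigenvectorBasis i)) :=
    mul_nonneg (by nlinarith) hx
  linarith

/-! ### Lower bound by the top eigenvalue, and telescoping -/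

lemma eigenvalue_sub_log_le (hn : 1 ≤ n) {Y : Matrix (Fin n) (Fin n) ℝ} (hY : Y.IsHermitian)
    {h0 : (0 : Matrix (Fin n) (Fin n) ℝ).IsHermitian} {c : ℝ} (h : PotentialGapLE h0 hY c)
    (i : Fin n) : hY.eigenvalues i - Real.log (4 * n) ≤ c := by
  obtain ⟨r, h1, h2, h3⟩ := h
  obtain ⟨k1, k2⟩ := sub_log_le_integral hn (hY.eigenvalues i)
  refine (k2.trans (setIntegral_mono_on k1 h1 measurableSet_Ioi fun t ht => ?_)).trans h3
  have ht' : 0 < t := ht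
  refine le_trans ?_ (h2 t ht')
  have e0 : spectralWeight h0 t = (√(1 + t))⁻¹ ^ n := by
    simp [spectralWeight, h0.eigenvalues_eq_zero_iff.2 rfl]
  -- All factors of the determinant except the i-th are at most 1 and are dropped.
  have e1 : spectralWeight hY t ≤ (√(1 + t * Real.exp (hY.eigenvalues i)))⁻¹ := by
    rw [spectralWeight, ← Finset.mul_prod_erase _ _ (Finset.mem_univ i)]
    refine mul_le_of_le_one_right (by positivity) (Finset.prod_le_one (fun j _ => by positivity)
      fun j _ => inv_le_one_of_one_le₀ ?_)
    rw [Real.one_le_sqrt]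
    have := mul_pos ht' (Real.exp_pos (hY.eigenvalues j))
    linarith
  rw [e0]
  gcongr

lemma lambdaMax_mem_spectrum (hn : 1 ≤ n) {A : Matrix (Fin n) (Fin n) ℝ} (hA : A.IsHermitian) :
    lambdaMax A ∈ spectrum ℝ A := by
  have : Nonempty (Fin n) := ⟨⟨0, hn⟩⟩
  rw [lambdaMax, hA.spectrum_real_eq_range_eigenvalues]
  exact (Set.range_nonempty _).csSup_mem (Set.finite_range _)

lemma mul_lambdaMax_sub_log_le (hn : 1 ≤ n) {S : Matrix (Fin n) (Fin n) ℝ} (hS : S.IsHermitian)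
    (η : ℝ) (hηS : (η • S).IsHermitian) {h0 : (0 : Matrix (Fin n) (Fin n) ℝ).IsHermitian}
    {c : ℝ} (h : PotentialGapLE h0 hηS c) : η * lambdaMax S - Real.log (4 * n) ≤ c := by
  have : Nonempty (Fin n) := ⟨⟨0, hn⟩⟩
  have hmem := lambdaMax_mem_spectrum hn hS
  have h1 : η * lambdaMax S ∈ spectrum ℝ (η • S) := by
    rw [spectrum.smul_eq_smul η S ⟨_, hmem⟩]
    exact Set.smul_mem_smul_set hmem
  rw [hηS.spectrum_real_eq_range_eigenvalues] at h1
  obtain ⟨i, hi⟩ := h1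
  rw [← hi]
  exact eigenvalue_sub_log_le hn hηS h i

lemma isHermitian_smul_sum {ι : Type*} (η : ℝ) (s : Finset ι)
    (G : ι → Matrix (Fin n) (Fin n) ℝ) (hG : ∀ t ∈ s, (G t).IsSymm) :
    (η • ∑ t ∈ s, G t).IsHermitian := by
  rw [Matrix.IsHermitian, Matrix.conjTranspose_smul, Matrix.conjTranspose_sum]
  simp only [star_trivial, Matrix.conjTranspose_eq_transpose_of_trivial]
  rw [Finset.sum_congr rfl fun t ht => (hG t ht).eq]

/-- Telescoping along the partial sums: `Ico 1 t` is what the action at time t has seen, `Icc 1 t`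
also includes G t. -/
lemma potentialGapLE_sum (η : ℝ) (T : ℕ)
    (G : ℕ → Matrix (Fin n) (Fin n) ℝ) (hG : ∀ t ∈ Finset.Icc 1 T, (G t).IsSymm) (c : ℕ → ℝ)
    (hstep : ∀ t ∈ Finset.Icc 1 T, ∀ (hA : (η • ∑ i ∈ Finset.Ico 1 t, G i).IsHermitian)
      (hB : (η • ∑ i ∈ Finset.Icc 1 t, G i).IsHermitian), PotentialGapLE hA hB (c t)) :
    PotentialGapLE Matrix.isHermitian_zero (isHermitian_smul_sum η _ G hG)
      (∑ t ∈ Finset.Icc 1 T, c t) := by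
  induction T with
  | zero =>
    have e : η • ∑ t ∈ Finset.Icc 1 0, G t = 0 := by simp
    simpa [e] using PotentialGapLE.refl (Matrix.isHermitian_zero (n := Fin n) (α := ℝ))
  | succ T ih =>
    have hG' : ∀ t ∈ Finset.Icc 1 T, (G t).IsSymm := fun t ht =>
      hG t (Finset.Icc_subset_Icc_right T.le_succ ht)
    have h1 := ih hG' fun t ht => hstep t (Finset.Icc_subset_Icc_right T.le_succ ht)
    have h2 := hstep (T + 1) (by simp) (isHermitian_smul_sum η _ G hG')
      (isHermitian_smul_sum η _ G hG)
    exact (h1.trans h2).mono (Finset.sum_Icc_succ_top (by omega) _).ge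

lemma smul_sum_Icc_sub (η : ℝ) (G : ℕ → Matrix (Fin n) (Fin n) ℝ) {t : ℕ} (ht : 1 ≤ t) :
    η • ∑ i ∈ Finset.Icc 1 t, G i - η • ∑ i ∈ Finset.Ico 1 t, G i = η • G t := by
  obtain ⟨s, rfl⟩ : ∃ s, t = s + 1 := ⟨t - 1, by omega⟩
  rw [← smul_sub, Finset.sum_Icc_succ_top (by omega)]
  congr 1
  exact add_sub_cancel_left _ _

end

end RankOneSketch

theorem theorem1 (n : ℕ) (hn : 1 ≤ n) (η : ℝ) (hη : 0 < η) (T : ℕ)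
    (G : ℕ → Matrix (Fin n) (Fin n) ℝ) (hG : ∀ t ∈ Finset.Icc 1 T, (G t).IsSymm) :
    (RankOneSketch.lambdaMax (∑ t ∈ Finset.Icc 1 T, G t)
        - ∑ t ∈ Finset.Icc 1 T,
            RankOneSketch.frobInner (G t) (RankOneSketch.avgAction η G t)
      ≤ Real.log (4 * (n : ℝ)) / η
        + 3 * η / 2 * ∑ t ∈ Finset.Icc 1 T, RankOneSketch.opNorm (G t) ^ 2) ∧
    ((∀ t ∈ Finset.Icc 1 T, (G t).PosSemidef ∧ (1 - G t).PosSemidef) → η ≤ 1 / 6 →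
      RankOneSketch.lambdaMax (∑ t ∈ Finset.Icc 1 T, G t)
          - ∑ t ∈ Finset.Icc 1 T,
              RankOneSketch.frobInner (G t) (RankOneSketch.avgAction η G t)
        ≤ Real.log (4 * (n : ℝ)) / η
          + 3 * η * RankOneSketch.lambdaMax (∑ t ∈ Finset.Icc 1 T, G t)) := by
  open RankOneSketch in
  have hS : (∑ t ∈ Finset.Icc 1 T, G t).IsHermitian := by
    simpa using isHermitian_smul_sum 1 _ G hG
  set s := ∑ t ∈ Finset.Icc 1 T, frobInner (G t) (avgAction η G t) with hs
  set l := lambdaMax (∑ t ∈ Finset.Icc 1 T, G t)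
  have hmul : ∀ {a b : ℝ}, η * a ≤ η * b → a ≤ b := fun h => le_of_mul_le_mul_left h hη
  have hlog : η * (Real.log (4 * (n : ℝ)) / η) = Real.log (4 * n) := mul_div_cancel₀ _ hη.ne'
  constructor
  · have h1 := mul_lambdaMax_sub_log_le hn hS η _ (potentialGapLE_sum η T G hG
      (fun t => η * frobInner (G t) (avgAction η G t) + 3 / 2 * (η * opNorm (G t)) ^ 2)
      fun t ht hA hB => by
        have h := potentialGapLE_opNorm hn hA hB
        rwa [smul_sum_Icc_sub η G (Finset.mem_Icc.1 ht).1, frobInner_smul_left, opNorm_smul,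
          abs_of_pos hη] at h)
    rw [Finset.sum_add_distrib, ← Finset.mul_sum, ← Finset.mul_sum, ← hs] at h1
    simp_rw [mul_pow] at h1
    rw [← Finset.mul_sum] at h1
    refine hmul ?_
    rw [mul_add, hlog]
    linarith
  · intro hpsd hη'
    have h1 := mul_lambdaMax_sub_log_le hn hS η _ (potentialGapLE_sum η T G hG
      (fun t => (1 + 3 * η) * (η * frobInner (G t) (avgAction η G t)))
      fun t ht hA hB => potentialGapLE_posSemidef hn hA hB hη hη' (hpsd t ht).1 (hpsd t ht).2
        (smul_sum_Icc_sub η G (Finset.mem_Icc.1 ht).1))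
    rw [← Finset.mul_sum, ← Finset.mul_sum, ← hs] at h1
    have hn' : (1 : ℝ) ≤ n := by exact_mod_cast hn
    have hlog0 : 0 ≤ Real.log (4 * (n : ℝ)) := Real.log_nonneg (by linarith)
    have hl : 0 ≤ l := by
      have hp := Matrix.posSemidef_sum (Finset.Icc 1 T) fun t ht => (hpsd t ht).1
      have hmem := lambdaMax_mem_spectrum hn hS
      rw [hp.1.spectrum_real_eq_range_eigenvalues] at hmem
      obtain ⟨i, hi⟩ := hmem
      refine le_of_le_of_eq ?_ hi
      exact hp.eigenvalues_nonneg i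
    have hl' : 0 ≤ 3 * η * l := by positivity
    -- The potential argument leaves 3η s in place of 3η l. If s ≤ l this is enough; otherwise the
    -- left side is nonpositive and the right side nonnegative.
    rcases le_total s l with h | h
    · refine hmul ?_
      rw [mul_add, hlog]
      have := mul_le_mul_of_nonneg_left h (show 0 ≤ 3 * η * η by positivity)
      linarith
    · have : 0 ≤ Real.log (4 * (n : ℝ)) / η := div_nonneg hlog0 hη.le
      linarith
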